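/- Write $\mathbb{I}=[0,1)$. For $n\in\mathbb{N}=\{0,1,2,\dots\}$ let $n=\sum_{j\ge 0}\varepsilon_j(n)2^j$, $\varepsilon_j(n)\in\{0,1\}$, be its binary expansion, let $|n|=\max\{j:\varepsilon_j(n)\neq 0\}$ for $n\ge 1$, and put $n(k)=\sum_{j=0}^{k}\varepsilon_j(n)2^j$ and $l_n=\sum_{k=1}^{n-1}\frac1k$. For $x\in\mathbb{I}$ let $x=\sum_{j\ge 0}x_j2^{-(j+1)}$, $x_j\in\{0,1\}$, be its binary expansion (the one terminating in zeros if $x$ is a dyadic rational), and let $w_n(x)=(-1)^{\sum_{k\ge 0}\varepsilon_k(n)x_k}$ be the Walsh–Paley functions. For $f\in L_1(\mathbb{I})$ let $$S_M(x,f)=\sum_{i=0}^{M-1}\widehat f(i)\,w_i(x),\qquad \widehat f(i)=\int_{\mathbb{I}}f(t)w_i(t)\,dt,$$ and let $$L_n(x,f)=\frac1{l_n}\sum_{k=1}^{n-1}\frac{S_k(x,f)}{n-k}\qquad(n\ge 2)$$ be the Nörlund logarithmic means of its Walsh–Fourier series. For $n\ge 2$ put $$V_L(n)=\frac1{|n|}\sum_{k=1}^{|n|}|\varepsilon_k(n)-\varepsilon_{k+1}(n)|\,l_{n(k-1)},\qquad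 M(n)=\frac1{|n|}\sum_{k=1}^{|n|}\varepsilon_k(n)\,l_{n(k-1)};$$ terms with $n\le 1$ play no role, and we set $V_L(n)=M(n)=0$ for them. **Theorem.** Let $f\in L_1(\mathbb{I})$, and let $(m_A)_{A\in\mathbb{N}}$ be a sequence of non-negative integers with $m_A\to\infty$ (for example a strictly increasing one) such that $\sup_A V_L(m_A)<\infty$. Then $L_{m_A}(x,f)\to f(x)$ as $A\to\infty$ for almost every $x\in\mathbb{I}$. This condition is strictly weaker than Memić's condition $\sup_A M(m_A)<\infty$: for every sequence $(m_A)$ of non-negative integers, $\sup_A M(m_A)<\infty$ implies $\sup_A V_L(m_A)<\infty$, whereas for $m_A=2^A-1$ one has $\sup_A V_L(m_A)<\infty$ but $\sup_A M(m_A)=\infty$. -/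

import Mathlib

open Filter Topology MeasureTheory

noncomputable section

namespace WalshLog

/-- The binary coefficient `ε_k(n) ∈ {0, 1}` of `n = ∑ ε_k(n) 2 ^ k`. -/
def eps (k n : ℕ) : ℕ := (n.testBit k).toNat

/-- The order `|n|` of `n ≥ 1`, i.e. `2 ^ |n| ≤ n < 2 ^ (|n| + 1)`. -/
def order (n : ℕ) : ℕ := Nat.log 2 n

/-- The truncation `n(k) = ∑_{j = 0}^{k} ε_j(n) 2 ^ j`. -/
def trunc (n k : ℕ) : ℕ := ∑ j ∈ Finset.range (k + 1), eps j n * 2 ^ j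

/-- The `k`-th Rademacher function `(-1) ^ x_k` on `[0, 1)`, where `x = ∑ x_k 2 ^ (-(k + 1))` is
the binary expansion which terminates in zeros if `x` is a dyadic rational. -/
def rademacher (k : ℕ) (x : ℝ) : ℝ := (-1) ^ (Real.digits x 2 k : ℕ)

/-- The `n`-th Walsh–Paley function. -/
def walsh (n : ℕ) (x : ℝ) : ℝ :=
  ∏ k ∈ Finset.range (order n + 1), rademacher k x ^ eps k n

/-- The `i`-th Walsh–Fourier coefficient of `f` on `[0, 1)`. -/
def coeff (f : ℝ → ℝ) (i : ℕ) : ℝ := ∫ t in Set.Ico (0 : ℝ) 1, f t * walsh i t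

/-- The partial sum `S_M(x, f) = ∑_{i < M} f^(i) w_i(x)` of the Walsh–Fourier series of `f`. -/
def partialSum (M : ℕ) (f : ℝ → ℝ) (x : ℝ) : ℝ :=
  ∑ i ∈ Finset.range M, coeff f i * walsh i x

/-- `l_n = ∑_{k = 1}^{n - 1} 1 / k`. -/
def ell (n : ℕ) : ℝ := ∑ k ∈ Finset.Ico 1 n, 1 / (k : ℝ)

/-- The `n`-th Nörlund logarithmic mean
`(1 / l_n) ∑_{k = 1}^{n - 1} S_k(x, f) / (n - k)` of the Walsh–Fourier series of `f`. -/
def logMean (n : ℕ) (f : ℝ → ℝ) (x : ℝ) : ℝ :=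
  1 / ell n * ∑ k ∈ Finset.Ico 1 n, partialSum k f x / ((n : ℝ) - (k : ℝ))

/-- The logarithmic variation
`V_L(n) = (1 / |n|) ∑_{k = 1}^{|n|} |ε_k(n) - ε_{k+1}(n)| l_{n(k-1)}`. -/
def logVariation (n : ℕ) : ℝ :=
  1 / (order n : ℝ) * ∑ k ∈ Finset.Icc 1 (order n),
    |(eps k n : ℝ) - (eps (k + 1) n : ℝ)| * ell (trunc n (k - 1))

/-- Memić's quantity `(1 / |n|) ∑_{k = 1}^{|n|} ε_k(n) l_{n(k-1)}`. -/
def memicSum (n : ℕ) : ℝ :=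
  1 / (order n : ℝ) * ∑ k ∈ Finset.Icc 1 (order n), (eps k n : ℝ) * ell (trunc n (k - 1))

end WalshLog

end

noncomputable section

namespace WalshLog

/-! ### Binary digits -/

/-! The convergence rests on a weak type (1,1) bound for the maximal function of the means, combined
with density of dyadic step functions, on which the means converge everywhere.

The kernel of `L_n` depends only on the signs `ρ k = r_k(x) r_k(t)`, so it is estimated pointwise
for an arbitrary sign sequence. Removing the leading binary digits one by one
(`logKernel_add_two_pow`) writes it as `w_n ∑ b_l (D_{2^(l+1)} - D_{2^l})` plus an error, where `b_l
= ε_l(n) l_{n(l)}` (`abs_logKernel_mod_sub_le`). Abel summation turns the main part into `∑ |b_(l+1)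
- b_l| D_{2^(l+1)}` with nonnegative kernels, and the variation of `b` is at most `2 |n| V_L(n) + 2
l_n`: along a run of ones it telescopes, and only changes of digit cost anything. The error is
dominated, independently of the digits of `n`, by normalised Fejér majorants at the `|n|` scales
below `n` (`abs_logKernel_le`).

All majorants are built from `D_{2^k}` and from kernels that ignore one digit. A stopping-time
argument, with the ignored digit flipped by a measure-preserving map, controls all of them off one
exceptional set of measure `O(‖F‖₁ / c)` (`exists_good_set`). There the unnormalised mean is `O((|n|
V_L(n) + l_n + |n|) c)`; since `|n| ≤ 2 l_n`, the mean is `O((V_L(n) + 1) c)` (`abs_logMean_le`).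

The comparison with Memić's condition is elementary: a change of digit involves a digit one, so `V_L
≤ 2 M`, while `2^A - 1` has one long run of ones, which `V_L` charges once and `M` at every digit.
-/

lemma eps_eq_zero_or_one (k n : ℕ) : eps k n = 0 ∨ eps k n = 1 := by
  unfold eps; cases n.testBit k <;> simp

lemma mod_two_pow_succ_eq (n k : ℕ) : n % 2 ^ (k + 1) = n % 2 ^ k + 2 ^ k * eps k n := by
  rw [pow_succ, Nat.mod_mul, eps, Nat.toNat_testBit]

lemma eps_eq_zero_of_lt {n k : ℕ} (h : n < 2 ^ k) : eps k n = 0 := by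
  simp [eps, Nat.testBit_lt_two_pow h]

lemma lt_two_pow_order_succ (n : ℕ) : n < 2 ^ (order n + 1) :=
  Nat.lt_pow_succ_log_self (by norm_num) n

lemma eps_two_pow_add {p i : ℕ} (hi : i < 2 ^ p) (k : ℕ) :
    eps k (2 ^ p + i) = if k = p then 1 else eps k i := by
  unfold eps
  split_ifs with h
  · subst h; simp [Nat.testBit_two_pow_add_eq, Nat.testBit_lt_two_pow hi]
  · rcases lt_or_gt_of_ne h with h | h
    · rw [Nat.testBit_two_pow_add_gt h]
    · rw [Nat.testBit_lt_two_pow, Nat.testBit_lt_two_pow]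
      · exact hi.trans (Nat.pow_lt_pow_right (by norm_num) h)
      · calc 2 ^ p + i < 2 ^ (p + 1) := by rw [pow_succ]; omega
          _ ≤ 2 ^ k := Nat.pow_le_pow_right (by norm_num) h

lemma trunc_eq_mod (n k : ℕ) : trunc n k = n % 2 ^ (k + 1) := by
  unfold trunc
  induction k with
  | zero => rw [mod_two_pow_succ_eq]; simp [Nat.mod_one]
  | succ k ih => rw [Finset.sum_range_succ, ih, mod_two_pow_succ_eq n (k + 1)]; ring

/-! ### Walsh functions of a sequence of signs -/

/-- The Walsh–Paley function of index `i` evaluated at a sequence of signs. -/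
def signWalsh (ρ : ℕ → ℝ) (i : ℕ) : ℝ := ∏ k ∈ Finset.range (order i + 1), ρ k ^ eps k i

/-- The Walsh–Dirichlet kernel at a sequence of signs. -/
def dirichlet (ρ : ℕ → ℝ) (n : ℕ) : ℝ := ∑ i ∈ Finset.range n, signWalsh ρ i

/-- The sum of the Dirichlet kernels of index less than `n`. -/
def dirichletSum (ρ : ℕ → ℝ) (n : ℕ) : ℝ := ∑ i ∈ Finset.range n, dirichlet ρ i

/-- The kernel of the `n`-th logarithmic mean without its normalisation. -/
def logKernel (ρ : ℕ → ℝ) (n : ℕ) : ℝ := ∑ j ∈ Finset.range n, dirichlet ρ (n - j) / (j : ℝ)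

/-- Up to the factor `2 ^ (k - 1)`, the indicator of `ρ l = 1` for all `l < k` with `l ≠ j`. -/
def skipKernel (ρ : ℕ → ℝ) (k j : ℕ) : ℝ := ∏ l ∈ (Finset.range k).erase j, (1 + ρ l)

lemma signWalsh_eq_prod (ρ : ℕ → ℝ) {i N : ℕ} (h : i < 2 ^ N) :
    signWalsh ρ i = ∏ k ∈ Finset.range N, ρ k ^ eps k i := by
  have key : ∀ M N : ℕ, M ≤ N → i < 2 ^ M →
      ∏ k ∈ Finset.range M, ρ k ^ eps k i = ∏ k ∈ Finset.range N, ρ k ^ eps k i := by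
    intro M N hMN hM
    refine Finset.prod_subset (Finset.range_subset_range.2 hMN) fun k _ hk => ?_
    have hk : M ≤ k := by simpa using hk
    rw [eps_eq_zero_of_lt (hM.trans_le (Nat.pow_le_pow_right (by norm_num) hk)), pow_zero]
  unfold signWalsh
  rcases le_total (order i + 1) N with h' | h'
  · exact key _ _ h' (lt_two_pow_order_succ i)
  · exact (key _ _ h' h).symm

lemma signWalsh_zero (ρ : ℕ → ℝ) : signWalsh ρ 0 = 1 := by
  rw [signWalsh_eq_prod ρ (N := 0) (by norm_num)]; simp

lemma signWalsh_two_pow_add (ρ : ℕ → ℝ) {p i : ℕ} (hi : i < 2 ^ p) :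
    signWalsh ρ (2 ^ p + i) = ρ p * signWalsh ρ i := by
  rw [signWalsh_eq_prod ρ (N := p + 1) (by rw [pow_succ]; omega), signWalsh_eq_prod ρ hi,
    Finset.prod_range_succ, mul_comm, eps_two_pow_add hi, if_pos rfl, pow_one]
  congr 1
  refine Finset.prod_congr rfl fun k hk => ?_
  rw [eps_two_pow_add hi, if_neg (Finset.mem_range.1 hk).ne]

lemma dirichlet_zero (ρ : ℕ → ℝ) : dirichlet ρ 0 = 0 := by simp [dirichlet]

lemma dirichlet_two_pow_add (ρ : ℕ → ℝ) {p j : ℕ} (hj : j ≤ 2 ^ p) :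
    dirichlet ρ (2 ^ p + j) = dirichlet ρ (2 ^ p) + ρ p * dirichlet ρ j := by
  unfold dirichlet
  rw [Finset.sum_range_add, Finset.mul_sum]
  congr 1
  exact Finset.sum_congr rfl fun i hi =>
    signWalsh_two_pow_add ρ ((Finset.mem_range.1 hi).trans_le hj)

lemma dirichlet_two_pow (ρ : ℕ → ℝ) (p : ℕ) :
    dirichlet ρ (2 ^ p) = ∏ l ∈ Finset.range p, (1 + ρ l) := by
  induction p with
  | zero => simp [dirichlet, signWalsh_zero]
  | succ p ih =>
    rw [pow_succ, mul_two, dirichlet_two_pow_add ρ le_rfl, ih, Finset.prod_range_succ]; ring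

lemma skipKernel_succ_self (ρ : ℕ → ℝ) (k : ℕ) :
    skipKernel ρ (k + 1) k = dirichlet ρ (2 ^ k) := by
  rw [dirichlet_two_pow, skipKernel, Finset.range_add_one, Finset.erase_insert (by simp)]

lemma skipKernel_succ (ρ : ℕ → ℝ) {k j : ℕ} (h : j < k) :
    skipKernel ρ (k + 1) j = (1 + ρ k) * skipKernel ρ k j := by
  rw [skipKernel, skipKernel, Finset.range_add_one, Finset.erase_insert_of_ne (by omega),
    Finset.prod_insert (by simp)]

section Signs

variable {ρ : ℕ → ℝ}

lemma one_add_sign_nonneg (hρ : ∀ k, ρ k = 1 ∨ ρ k = -1) (k : ℕ) : 0 ≤ 1 + ρ k := by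
  rcases hρ k with h | h <;> rw [h] <;> norm_num

lemma sign_mul_self (hρ : ∀ k, ρ k = 1 ∨ ρ k = -1) (k : ℕ) : ρ k * ρ k = 1 := by
  rcases hρ k with h | h <;> rw [h] <;> norm_num

lemma abs_sign (hρ : ∀ k, ρ k = 1 ∨ ρ k = -1) (k : ℕ) : |ρ k| = 1 := by
  rcases hρ k with h | h <;> rw [h] <;> norm_num

lemma skipKernel_nonneg (hρ : ∀ k, ρ k = 1 ∨ ρ k = -1) (k j : ℕ) : 0 ≤ skipKernel ρ k j :=
  Finset.prod_nonneg fun l _ => one_add_sign_nonneg hρ l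

lemma dirichlet_two_pow_nonneg (hρ : ∀ k, ρ k = 1 ∨ ρ k = -1) (k : ℕ) :
    0 ≤ dirichlet ρ (2 ^ k) := by
  rw [← skipKernel_succ_self]; exact skipKernel_nonneg hρ _ _

lemma abs_signWalsh (hρ : ∀ k, ρ k = 1 ∨ ρ k = -1) (i : ℕ) : |signWalsh ρ i| = 1 := by
  rw [signWalsh, Finset.abs_prod]
  exact Finset.prod_eq_one fun k _ => by rw [abs_pow, abs_sign hρ, one_pow]

/-- Subtraction from `2 ^ p - 1` complements the first `p` binary digits, and a sign satisfies `ρ ^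
(1 - ε) = ρ * ρ ^ ε`. Summed up, this expresses `D_{2^p - j}` through `D_j`. -/
lemma signWalsh_reflect (hρ : ∀ k, ρ k = 1 ∨ ρ k = -1) (p : ℕ) : ∀ i < 2 ^ p,
    signWalsh ρ (2 ^ p - 1 - i) = (∏ k ∈ Finset.range p, ρ k) * signWalsh ρ i := by
  induction p with
  | zero => intro i hi; obtain rfl : i = 0 := by simpa using hi
            simp
  | succ p ih =>
    intro i hi
    rw [Finset.prod_range_succ]
    have h2 : 2 ^ (p + 1) = 2 ^ p + 2 ^ p := by ring
    rcases lt_or_ge i (2 ^ p) with h | h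
    · rw [show 2 ^ (p + 1) - 1 - i = 2 ^ p + (2 ^ p - 1 - i) by omega,
        signWalsh_two_pow_add ρ (by omega), ih i h]
      ring
    · obtain ⟨i', rfl⟩ := Nat.exists_eq_add_of_le h
      rw [show 2 ^ (p + 1) - 1 - (2 ^ p + i') = 2 ^ p - 1 - i' by omega, ih i' (by omega),
        signWalsh_two_pow_add ρ (by omega)]
      linear_combination (-(∏ k ∈ Finset.range p, ρ k) * signWalsh ρ i') * sign_mul_self hρ p

lemma dirichlet_reflect (hρ : ∀ k, ρ k = 1 ∨ ρ k = -1) {p j : ℕ} (hj : j ≤ 2 ^ p) :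
    dirichlet ρ (2 ^ p - j) =
      dirichlet ρ (2 ^ p) - (∏ k ∈ Finset.range p, ρ k) * dirichlet ρ j := by
  induction j with
  | zero => simp [dirichlet_zero]
  | succ j ih =>
    have ih := ih (by omega)
    have h1 : dirichlet ρ (2 ^ p - j) =
        dirichlet ρ (2 ^ p - (j + 1)) + signWalsh ρ (2 ^ p - 1 - j) := by
      rw [show 2 ^ p - j = 2 ^ p - (j + 1) + 1 by omega]
      unfold dirichlet
      rw [Finset.sum_range_succ]
      congr 2; omega
    have h2 : dirichlet ρ (j + 1) = dirichlet ρ j + signWalsh ρ j := Finset.sum_range_succ _ _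
    rw [signWalsh_reflect hρ p j (by omega)] at h1
    rw [h2]; linarith

/-! ### Fejér sums -/

lemma dirichletSum_two_pow_add (ρ : ℕ → ℝ) {p j : ℕ} (hj : j ≤ 2 ^ p) :
    dirichletSum ρ (2 ^ p + j) =
      dirichletSum ρ (2 ^ p) + (j * dirichlet ρ (2 ^ p) + ρ p * dirichletSum ρ j) := by
  unfold dirichletSum
  rw [Finset.sum_range_add]
  congr 1
  rw [Finset.sum_congr rfl fun i hi =>
    dirichlet_two_pow_add ρ ((Finset.mem_range.1 hi).le.trans hj), Finset.sum_add_distrib,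
    ← Finset.mul_sum]
  simp

/-- Doubling the index multiplies the old sum by `1 + ρ k` and adds `2 ^ k * D_{2^k}`, the new skip
kernel. For signs every summand is nonnegative. -/
lemma dirichletSum_two_pow (ρ : ℕ → ℝ) (k : ℕ) :
    dirichletSum ρ (2 ^ k) = ∑ j ∈ Finset.range k, 2 ^ j * skipKernel ρ k j := by
  induction k with
  | zero => simp [dirichletSum, dirichlet_zero]
  | succ k ih =>
    have h : ∑ j ∈ Finset.range k, 2 ^ j * skipKernel ρ (k + 1) j =
        (1 + ρ k) * ∑ j ∈ Finset.range k, 2 ^ j * skipKernel ρ k j := by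
      rw [Finset.mul_sum]
      exact Finset.sum_congr rfl fun j hj => by
        rw [skipKernel_succ ρ (Finset.mem_range.1 hj)]; ring
    rw [pow_succ, mul_two, dirichletSum_two_pow_add ρ le_rfl, ih, Finset.sum_range_succ,
      skipKernel_succ_self, h]
    push_cast
    ring

/-- The nonnegative majorant of the Fejér sums on a dyadic block. -/
def fejerBlock (ρ : ℕ → ℝ) (k : ℕ) : ℝ :=
  2 ^ k * dirichlet ρ (2 ^ k) + ∑ j ∈ Finset.range k, 2 ^ j * skipKernel ρ k j

/-- The nonnegative majorant of the Fejér sums of index at most `2 ^ p`. -/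
def fejerMajorant (ρ : ℕ → ℝ) (p : ℕ) : ℝ := ∑ k ∈ Finset.range p, fejerBlock ρ k

lemma fejerBlock_nonneg (hρ : ∀ k, ρ k = 1 ∨ ρ k = -1) (k : ℕ) : 0 ≤ fejerBlock ρ k := by
  have := dirichlet_two_pow_nonneg hρ k
  have := Finset.sum_nonneg fun j (_ : j ∈ Finset.range k) =>
    mul_nonneg (pow_nonneg (by norm_num : (0 : ℝ) ≤ 2) j) (skipKernel_nonneg hρ k j)
  unfold fejerBlock; positivity

lemma fejerMajorant_nonneg (hρ : ∀ k, ρ k = 1 ∨ ρ k = -1) (p : ℕ) : 0 ≤ fejerMajorant ρ p :=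
  Finset.sum_nonneg fun k _ => fejerBlock_nonneg hρ k

lemma fejerMajorant_mono (hρ : ∀ k, ρ k = 1 ∨ ρ k = -1) {p q : ℕ} (h : p ≤ q) :
    fejerMajorant ρ p ≤ fejerMajorant ρ q :=
  Finset.sum_le_sum_of_subset_of_nonneg (Finset.range_subset_range.2 h)
    fun k _ _ => fejerBlock_nonneg hρ k

/-- For `n = 2 ^ p + j` the complete block and the term `j * D_{2^p}` are absorbed by the two parts
of `fejerBlock ρ p`; the remaining sum of length `j` falls under the induction hypothesis. -/
lemma abs_dirichletSum_le (hρ : ∀ k, ρ k = 1 ∨ ρ k = -1) (p : ℕ) : ∀ n ≤ 2 ^ p,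
    |dirichletSum ρ n| ≤ fejerMajorant ρ p := by
  induction p with
  | zero =>
    intro n hn
    have : n = 0 ∨ n = 1 := by simp at hn; omega
    rcases this with rfl | rfl <;> simp [dirichletSum, dirichlet_zero, fejerMajorant]
  | succ p ih =>
    intro n hn
    rcases le_or_gt n (2 ^ p) with h | h
    · exact (ih n h).trans (fejerMajorant_mono hρ (Nat.le_succ p))
    · obtain ⟨j, rfl⟩ := Nat.exists_eq_add_of_le h.le
      have hj : j ≤ 2 ^ p := by rw [pow_succ] at hn; omega
      rw [dirichletSum_two_pow_add ρ hj, dirichletSum_two_pow, fejerMajorant,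
        Finset.sum_range_succ, ← fejerMajorant, fejerBlock]
      have h1 := ih j hj
      have h2 : |ρ p * dirichletSum ρ j| = |dirichletSum ρ j| := by
        rw [abs_mul, abs_sign hρ, one_mul]
      have h3 : (j : ℝ) * dirichlet ρ (2 ^ p) ≤ 2 ^ p * dirichlet ρ (2 ^ p) := by
        have := dirichlet_two_pow_nonneg hρ p
        gcongr; exact_mod_cast hj
      have h4 : 0 ≤ (j : ℝ) * dirichlet ρ (2 ^ p) :=
        mul_nonneg (Nat.cast_nonneg _) (dirichlet_two_pow_nonneg hρ p)
      have h5 := Finset.sum_nonneg fun j (_ : j ∈ Finset.range p) =>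
        mul_nonneg (pow_nonneg (by norm_num : (0 : ℝ) ≤ 2) j) (skipKernel_nonneg hρ p j)
      rw [← h2] at h1
      rw [abs_le] at *
      constructor <;> linarith

/-- Abel's inequality. -/
lemma abs_sum_mul_le_of_antitone {d a : ℕ → ℝ} {B : ℝ} (ha : Antitone a) (ha0 : ∀ i, 0 ≤ a i) :
    ∀ N : ℕ, (∀ j ≤ N, |∑ i ∈ Finset.range j, d i| ≤ B) →
      |∑ i ∈ Finset.range N, d i * a i| ≤ B * a 0 := by
  intro N hB
  have hB0 : 0 ≤ B := (abs_nonneg _).trans (hB 0 (Nat.zero_le _))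
  have key : ∀ M ≤ N, |∑ i ∈ Finset.range M, d i * a i - (∑ i ∈ Finset.range M, d i) * a M|
      ≤ B * (a 0 - a M) := by
    intro M hM
    induction M with
    | zero => simp
    | succ M ih =>
      have ih := ih (by omega)
      have h1 : |(∑ i ∈ Finset.range (M + 1), d i) * (a M - a (M + 1))| ≤
          B * (a M - a (M + 1)) := by
        have h0 : 0 ≤ a M - a (M + 1) := sub_nonneg.2 (ha (Nat.le_succ M))
        rw [abs_mul, abs_of_nonneg h0]
        exact mul_le_mul_of_nonneg_right (hB _ hM) h0
      have h2 : ∑ i ∈ Finset.range (M + 1), d i * a i -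
          (∑ i ∈ Finset.range (M + 1), d i) * a (M + 1) =
          (∑ i ∈ Finset.range M, d i * a i - (∑ i ∈ Finset.range M, d i) * a M) +
          (∑ i ∈ Finset.range (M + 1), d i) * (a M - a (M + 1)) := by
        rw [Finset.sum_range_succ, Finset.sum_range_succ d]; ring
      rw [h2]
      refine (abs_add_le _ _).trans ?_
      linarith
  have h1 := key N le_rfl
  have h2 : |(∑ i ∈ Finset.range N, d i) * a N| ≤ B * a N := by
    rw [abs_mul, abs_of_nonneg (ha0 N)]
    exact mul_le_mul_of_nonneg_right (hB _ le_rfl) (ha0 N)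
  rw [abs_le] at *
  constructor <;> linarith

/-- Shifted logarithmic averages of Dirichlet kernels. -/
def shiftedSum (ρ : ℕ → ℝ) (a m : ℕ) : ℝ :=
  ∑ i ∈ Finset.range (2 ^ a), dirichlet ρ i / ((m + i : ℕ) : ℝ)

/-- On each block `[2^p, 2^(p+1))` the weights `1 / (m + i)` decrease, so Abel's inequality costs
only the first weight times a bound for the partial sums of the Dirichlet kernels. The index `i = 0`
is harmless because `D_0 = 0`. -/
lemma abs_shiftedSum_le (hρ : ∀ k, ρ k = 1 ∨ ρ k = -1) (a m : ℕ) :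
    |shiftedSum ρ a m| ≤
      ∑ p ∈ Finset.range a, fejerMajorant ρ (p + 1) / ((m + 2 ^ p : ℕ) : ℝ) := by
  induction a with
  | zero => simp [shiftedSum, dirichlet_zero]
  | succ a ih =>
    have h : shiftedSum ρ (a + 1) m = shiftedSum ρ a m +
        ∑ i ∈ Finset.range (2 ^ a), dirichlet ρ (2 ^ a + i) * (1 / ((m + (2 ^ a + i) : ℕ) : ℝ)) := by
      unfold shiftedSum
      rw [pow_succ, mul_two, Finset.sum_range_add]
      congr 1
      exact Finset.sum_congr rfl fun i _ => by rw [mul_one_div]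
    rw [h, Finset.sum_range_succ]
    refine (abs_add_le _ _).trans (add_le_add ih ?_)
    have := abs_sum_mul_le_of_antitone (d := fun i => dirichlet ρ (2 ^ a + i))
      (a := fun i => 1 / ((m + (2 ^ a + i) : ℕ) : ℝ)) (B := fejerMajorant ρ (a + 1))
      (fun i j hij => ?_) (fun i => by positivity) (2 ^ a) (fun j hj => ?_)
    · refine this.trans_eq ?_
      simp [div_eq_mul_inv]
    · have : 0 < 2 ^ a := by positivity
      exact one_div_le_one_div_of_le (by exact_mod_cast (by omega)) (by exact_mod_cast (by omega))
    · have h1 : ∑ i ∈ Finset.range j, dirichlet ρ (2 ^ a + i) =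
          j * dirichlet ρ (2 ^ a) + ρ a * dirichletSum ρ j := by
        have := dirichletSum_two_pow_add ρ hj
        unfold dirichletSum at this ⊢
        rw [Finset.sum_range_add] at this
        linarith
      rw [h1, fejerMajorant, Finset.sum_range_succ, ← fejerMajorant, fejerBlock]
      have h1 := abs_dirichletSum_le hρ a j hj
      have h2 : |ρ a * dirichletSum ρ j| = |dirichletSum ρ j| := by
        rw [abs_mul, abs_sign hρ, one_mul]
      have h3 : (j : ℝ) * dirichlet ρ (2 ^ a) ≤ 2 ^ a * dirichlet ρ (2 ^ a) := by
        have := dirichlet_two_pow_nonneg hρ a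
        gcongr; exact_mod_cast hj
      have h4 : 0 ≤ (j : ℝ) * dirichlet ρ (2 ^ a) :=
        mul_nonneg (Nat.cast_nonneg _) (dirichlet_two_pow_nonneg hρ a)
      have h5 := Finset.sum_nonneg fun j (_ : j ∈ Finset.range a) =>
        mul_nonneg (pow_nonneg (by norm_num : (0 : ℝ) ≤ 2) j) (skipKernel_nonneg hρ a j)
      rw [← h2] at h1
      rw [abs_le] at *
      constructor <;> linarith

end Signs

/-! ### Harmonic sums -/

lemma ell_eq_sum_range (n : ℕ) : ell n = ∑ k ∈ Finset.range n, 1 / (k : ℝ) := by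
  cases n with
  | zero => simp [ell]
  | succ n =>
    rw [Finset.range_eq_Ico, Finset.sum_eq_sum_Ico_succ_bot (Nat.succ_pos n)]
    simp [ell]

lemma ell_mono : Monotone ell := by
  intro m n h
  rw [ell_eq_sum_range, ell_eq_sum_range]
  exact Finset.sum_le_sum_of_subset_of_nonneg (Finset.range_subset_range.2 h)
    fun k _ _ => by positivity

lemma ell_zero : ell 0 = 0 := by simp [ell]

lemma ell_nonneg (n : ℕ) : 0 ≤ ell n := by
  rw [← ell_zero]; exact ell_mono (Nat.zero_le n)

lemma ell_two_pow_succ (a : ℕ) :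
    ell (2 ^ (a + 1)) = ell (2 ^ a) + ∑ i ∈ Finset.range (2 ^ a), 1 / ((2 ^ a + i : ℕ) : ℝ) := by
  rw [ell_eq_sum_range, ell_eq_sum_range, pow_succ, mul_two, Finset.sum_range_add]

lemma half_le_ell_two_pow (a : ℕ) : (a : ℝ) / 2 ≤ ell (2 ^ a) := by
  induction a with
  | zero => simp [ell_nonneg]
  | succ a ih =>
    rw [ell_two_pow_succ]
    have : ∑ i ∈ Finset.range (2 ^ a), (1 : ℝ) / (2 ^ (a + 1)) ≤
        ∑ i ∈ Finset.range (2 ^ a), 1 / ((2 ^ a + i : ℕ) : ℝ) := by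
      refine Finset.sum_le_sum fun i hi => ?_
      have hi := Finset.mem_range.1 hi
      refine one_div_le_one_div_of_le (by positivity) ?_
      have : 2 ^ a + i ≤ 2 ^ (a + 1) := by rw [pow_succ]; omega
      exact_mod_cast this
    rw [Finset.sum_const, Finset.card_range, nsmul_eq_mul] at this
    have h : ((2 ^ a : ℕ) : ℝ) * (1 / 2 ^ (a + 1)) = 1 / 2 := by
      push_cast; rw [pow_succ]; field_simp
    push_cast at *
    linarith

lemma ell_two_pow_le (a : ℕ) : ell (2 ^ a) ≤ a := by
  induction a with
  | zero => simp [ell]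
  | succ a ih =>
    rw [ell_two_pow_succ]
    have : ∑ i ∈ Finset.range (2 ^ a), 1 / ((2 ^ a + i : ℕ) : ℝ) ≤
        ∑ i ∈ Finset.range (2 ^ a), (1 : ℝ) / 2 ^ a := by
      refine Finset.sum_le_sum fun i hi => ?_
      refine one_div_le_one_div_of_le (by positivity) ?_
      push_cast; linarith [(Nat.cast_nonneg i : (0 : ℝ) ≤ i)]
    rw [Finset.sum_const, Finset.card_range, nsmul_eq_mul] at this
    have h : ((2 ^ a : ℕ) : ℝ) * (1 / 2 ^ a) = 1 := by push_cast; field_simp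
    push_cast at *
    linarith

lemma order_le_two_mul_ell {n : ℕ} (hn : n ≠ 0) : (order n : ℝ) ≤ 2 * ell n := by
  have h1 := half_le_ell_two_pow (order n)
  have h2 := ell_mono (Nat.pow_log_le_self 2 hn)
  unfold order at *
  linarith

/-! ### Decomposition of the logarithmic kernel -/

lemma order_mod_succ (n : ℕ) : n % 2 ^ (order n + 1) = n :=
  Nat.mod_eq_of_lt (lt_two_pow_order_succ n)

/-- The sum is cut at `j = m`. Below the cut the kernel index is `2 ^ a + (m - j)` and the leading
digit splits off; above it the index is `2 ^ a - i` and reflection applies. -/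
lemma logKernel_add_two_pow {ρ : ℕ → ℝ} (hρ : ∀ k, ρ k = 1 ∨ ρ k = -1) {a m : ℕ}
    (hm : m ≤ 2 ^ a) :
    logKernel ρ (m + 2 ^ a) = ell (m + 2 ^ a) * dirichlet ρ (2 ^ a)
      - (∏ k ∈ Finset.range a, ρ k) * shiftedSum ρ a m + ρ a * logKernel ρ m := by
  have h1 : ∑ j ∈ Finset.range m, dirichlet ρ (m + 2 ^ a - j) / (j : ℝ) =
      (∑ j ∈ Finset.range m, 1 / (j : ℝ)) * dirichlet ρ (2 ^ a) + ρ a * logKernel ρ m := by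
    rw [logKernel, Finset.sum_mul, Finset.mul_sum, ← Finset.sum_add_distrib]
    refine Finset.sum_congr rfl fun j hj => ?_
    have hj := Finset.mem_range.1 hj
    rw [show m + 2 ^ a - j = 2 ^ a + (m - j) by omega, dirichlet_two_pow_add ρ (by omega)]
    ring
  have h2 : ∑ i ∈ Finset.range (2 ^ a), dirichlet ρ (m + 2 ^ a - (m + i)) / ((m + i : ℕ) : ℝ) =
      (∑ i ∈ Finset.range (2 ^ a), 1 / ((m + i : ℕ) : ℝ)) * dirichlet ρ (2 ^ a)
        - (∏ k ∈ Finset.range a, ρ k) * shiftedSum ρ a m := by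
    rw [shiftedSum, Finset.sum_mul, Finset.mul_sum, ← Finset.sum_sub_distrib]
    refine Finset.sum_congr rfl fun i hi => ?_
    have hi := Finset.mem_range.1 hi
    rw [show m + 2 ^ a - (m + i) = 2 ^ a - i by omega, dirichlet_reflect hρ hi.le]
    ring
  rw [ell_eq_sum_range, Finset.sum_range_add, add_mul, logKernel, Finset.sum_range_add, h1, h2]
  ring

/-- `D_{2^K}` vanishes unless the first `K` signs are all `1`, and there `w_i = 1`. -/
lemma signWalsh_mul_dirichlet_two_pow {ρ : ℕ → ℝ} (hρ : ∀ k, ρ k = 1 ∨ ρ k = -1) {i K : ℕ}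
    (hi : i < 2 ^ K) : signWalsh ρ i * dirichlet ρ (2 ^ K) = dirichlet ρ (2 ^ K) := by
  by_cases h : ∀ l < K, ρ l = 1
  · rw [signWalsh_eq_prod ρ hi, Finset.prod_eq_one, one_mul]
    intro k hk
    rw [h k (Finset.mem_range.1 hk), one_pow]
  · push Not at h
    obtain ⟨l, hl, h⟩ := h
    have h : ρ l = -1 := (hρ l).resolve_left h
    rw [dirichlet_two_pow, Finset.prod_eq_zero (Finset.mem_range.2 hl) (by rw [h]; norm_num),
      mul_zero]

/-- The weight of the block of the `k`-th binary digit of `n`. -/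
def digitWeight (n k : ℕ) : ℝ := eps k n * ell (n % 2 ^ (k + 1))

/-- The recursion iterated over the digits of `n`. A digit one multiplies the earlier discrepancy by
the sign `ρ K`, since `ρ K * D_{2^K} = D_{2^(K+1)} - D_{2^K}` and the Walsh factor is invisible on
the support of `D_{2^K}`; only the shifted sum is new. -/
lemma abs_logKernel_mod_sub_le {ρ : ℕ → ℝ} (hρ : ∀ k, ρ k = 1 ∨ ρ k = -1) (n K : ℕ) :
    |logKernel ρ (n % 2 ^ K) - signWalsh ρ (n % 2 ^ K) *
        ∑ l ∈ Finset.range K, digitWeight n l * (dirichlet ρ (2 ^ (l + 1)) - dirichlet ρ (2 ^ l))|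
      ≤ ∑ k ∈ Finset.range K, eps k n * |shiftedSum ρ k (n % 2 ^ k)| := by
  induction K with
  | zero => simp [Nat.mod_one, logKernel]
  | succ K ih =>
    have ht : n % 2 ^ K < 2 ^ K := Nat.mod_lt _ (by positivity)
    rw [Finset.sum_range_succ, Finset.sum_range_succ]
    rcases eps_eq_zero_or_one K n with h | h
    · have : n % 2 ^ (K + 1) = n % 2 ^ K := by rw [mod_two_pow_succ_eq, h]; simp
      simpa [this, digitWeight, h] using ih
    · have hs : n % 2 ^ (K + 1) = n % 2 ^ K + 2 ^ K := by rw [mod_two_pow_succ_eq, h]; simp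
      have hw : signWalsh ρ (n % 2 ^ (K + 1)) = ρ K * signWalsh ρ (n % 2 ^ K) := by
        rw [hs, add_comm, signWalsh_two_pow_add ρ ht]
      have hD : dirichlet ρ (2 ^ (K + 1)) - dirichlet ρ (2 ^ K) = ρ K * dirichlet ρ (2 ^ K) := by
        rw [pow_succ, mul_two, dirichlet_two_pow_add ρ le_rfl]; ring
      have hG := logKernel_add_two_pow hρ ht.le
      rw [← hs] at hG
      have hWD := signWalsh_mul_dirichlet_two_pow hρ ht
      rw [hw, hD, hG, digitWeight, h]
      have hσ : |∏ k ∈ Finset.range K, ρ k| = 1 := by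
        rw [Finset.abs_prod]; exact Finset.prod_eq_one fun k _ => abs_sign hρ k
      set P := ∑ l ∈ Finset.range K,
        digitWeight n l * (dirichlet ρ (2 ^ (l + 1)) - dirichlet ρ (2 ^ l))
      have e : ell (n % 2 ^ (K + 1)) * dirichlet ρ (2 ^ K)
          - (∏ k ∈ Finset.range K, ρ k) * shiftedSum ρ K (n % 2 ^ K)
          + ρ K * logKernel ρ (n % 2 ^ K) - ρ K * signWalsh ρ (n % 2 ^ K) *
          (P + ((1 : ℕ) : ℝ) * ell (n % 2 ^ (K + 1)) * (ρ K * dirichlet ρ (2 ^ K))) =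
          ρ K * (logKernel ρ (n % 2 ^ K) - signWalsh ρ (n % 2 ^ K) * P) -
          (∏ k ∈ Finset.range K, ρ k) * shiftedSum ρ K (n % 2 ^ K) := by
        push_cast
        linear_combination (-ell (n % 2 ^ (K + 1)) * signWalsh ρ (n % 2 ^ K) *
          dirichlet ρ (2 ^ K)) * sign_mul_self hρ K - ell (n % 2 ^ (K + 1)) * hWD
      rw [e]
      refine (abs_sub _ _).trans ?_
      rw [abs_mul, abs_mul, abs_sign hρ, hσ]
      push_cast
      linarith

lemma sum_weight_mul_sub (b D : ℕ → ℝ) (K : ℕ) :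
    ∑ l ∈ Finset.range K, b l * (D (l + 1) - D l) =
      b K * D K - b 0 * D 0 - ∑ l ∈ Finset.range K, (b (l + 1) - b l) * D (l + 1) := by
  induction K with
  | zero => simp
  | succ K ih => rw [Finset.sum_range_succ, ih, Finset.sum_range_succ]; ring

/-- Each digit one at least doubles the truncation up to a bounded factor, so the nonzero terms
decay geometrically. This makes the error bound independent of the number of ones in `n`. -/
lemma sum_digit_ratio_le (n p K : ℕ) :
    ∑ k ∈ Finset.Ico (p + 1) K, (eps k n : ℝ) * (2 ^ p / ((n % 2 ^ k + 2 ^ p : ℕ) : ℝ)) ≤ 3 := by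
  rcases lt_or_ge K (p + 1) with hK | hK
  · rw [Finset.Ico_eq_empty_of_le hK.le]; simp
  -- At a digit one the ratio shrinks by a factor at most `3/5`, so it is at most `5/2 = 1 / (1 -
  -- 3/5)` times its own decrease, and the decreases telescope.
  have key : ∑ k ∈ Finset.Ico (p + 1) K, (eps k n : ℝ) * (2 ^ p / ((n % 2 ^ k + 2 ^ p : ℕ) : ℝ)) ≤
      5 / 2 * (1 - 2 ^ p / ((n % 2 ^ K + 2 ^ p : ℕ) : ℝ)) := by
    induction K, hK using Nat.le_induction with
    | base =>
      have : (2 : ℝ) ^ p / ((n % 2 ^ (p + 1) + 2 ^ p : ℕ) : ℝ) ≤ 1 := by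
        rw [div_le_one (by positivity)]; push_cast; linarith [(Nat.cast_nonneg (n % 2 ^ (p + 1)) : (0 : ℝ) ≤ _)]
      simp only [Finset.Ico_self, Finset.sum_empty]
      linarith
    | succ K hK ih =>
      rw [Finset.sum_Ico_succ_top hK]
      rcases eps_eq_zero_or_one K n with h | h
      · have : n % 2 ^ (K + 1) = n % 2 ^ K := by rw [mod_two_pow_succ_eq, h]; simp
        simpa [this, h] using ih
      · have hs : n % 2 ^ (K + 1) = n % 2 ^ K + 2 ^ K := by rw [mod_two_pow_succ_eq, h]; simp
        have ht : n % 2 ^ K < 2 ^ K := Nat.mod_lt _ (by positivity)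
        have hp : 2 * 2 ^ p ≤ 2 ^ K := by
          rw [← pow_succ']; exact Nat.pow_le_pow_right (by norm_num) hK
        rw [h, hs]
        have ht' : ((n % 2 ^ K : ℕ) : ℝ) ≤ 2 ^ K := by exact_mod_cast ht.le
        have hp' : 2 * (2 : ℝ) ^ p ≤ 2 ^ K := by exact_mod_cast hp
        have h0 : (0 : ℝ) ≤ ((n % 2 ^ K : ℕ) : ℝ) := Nat.cast_nonneg _
        have hq : (0 : ℝ) < 2 ^ p := by positivity
        push_cast at ih ⊢
        generalize ((n % 2 ^ K : ℕ) : ℝ) = t at *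
        generalize (2 : ℝ) ^ p = q at *
        generalize (2 : ℝ) ^ K = X at *
        have : q / (t + X + q) ≤ 3 / 5 * (q / (t + q)) := by
          rw [← mul_div_assoc, div_le_div_iff₀ (by linarith) (by linarith)]
          nlinarith
        linarith
  have : (0 : ℝ) ≤ 2 ^ p / ((n % 2 ^ K + 2 ^ p : ℕ) : ℝ) := by positivity
  linarith

lemma sum_digit_mul_abs_shiftedSum_le {ρ : ℕ → ℝ} (hρ : ∀ k, ρ k = 1 ∨ ρ k = -1) (n N : ℕ) :
    ∑ k ∈ Finset.range (N + 1), eps k n * |shiftedSum ρ k (n % 2 ^ k)| ≤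
      3 * ∑ p ∈ Finset.range N, fejerMajorant ρ (p + 1) / 2 ^ p := by
  calc ∑ k ∈ Finset.range (N + 1), eps k n * |shiftedSum ρ k (n % 2 ^ k)|
      ≤ ∑ k ∈ Finset.range (N + 1), ∑ p ∈ Finset.range k,
          eps k n * (fejerMajorant ρ (p + 1) / ((n % 2 ^ k + 2 ^ p : ℕ) : ℝ)) := by
        refine Finset.sum_le_sum fun k _ => ?_
        rw [← Finset.mul_sum]
        exact mul_le_mul_of_nonneg_left (abs_shiftedSum_le hρ _ _) (Nat.cast_nonneg _)
    _ = ∑ p ∈ Finset.range N, ∑ k ∈ Finset.Ico (p + 1) (N + 1),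
          eps k n * (fejerMajorant ρ (p + 1) / ((n % 2 ^ k + 2 ^ p : ℕ) : ℝ)) := by
        refine Finset.sum_comm' fun k p => ?_
        simp only [Finset.mem_range, Finset.mem_Ico]; omega
    _ ≤ ∑ p ∈ Finset.range N, 3 * (fejerMajorant ρ (p + 1) / 2 ^ p) := by
        refine Finset.sum_le_sum fun p _ => ?_
        have h1 : 0 ≤ fejerMajorant ρ (p + 1) / 2 ^ p :=
          div_nonneg (fejerMajorant_nonneg hρ _) (by positivity)
        refine le_trans (le_of_eq ?_)
          (mul_le_mul_of_nonneg_right (sum_digit_ratio_le n p (N + 1)) h1)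
        rw [Finset.sum_mul]
        refine Finset.sum_congr rfl fun k _ => ?_
        have : ((n % 2 ^ k + 2 ^ p : ℕ) : ℝ) ≠ 0 := by positivity
        field_simp
    _ = _ := by rw [Finset.mul_sum]

/-- Abel summation has no boundary terms: the weight at `0` vanishes because `l_0 = l_1 = 0`, and
the weight past the leading digit because that digit is zero. -/
lemma abs_logKernel_le {ρ : ℕ → ℝ} (hρ : ∀ k, ρ k = 1 ∨ ρ k = -1) (n : ℕ) :
    |logKernel ρ n| ≤
      ∑ l ∈ Finset.range (order n + 1),
        |digitWeight n (l + 1) - digitWeight n l| * dirichlet ρ (2 ^ (l + 1)) +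
      3 * ∑ p ∈ Finset.range (order n), fejerMajorant ρ (p + 1) / 2 ^ p := by
  have h1 := abs_logKernel_mod_sub_le hρ n (order n + 1)
  rw [order_mod_succ] at h1
  have h2 := sum_digit_mul_abs_shiftedSum_le hρ n (order n)
  have h0 : digitWeight n 0 = 0 := by
    have : n % 2 < 2 := Nat.mod_lt _ (by norm_num)
    have : ell (n % 2) = 0 := by interval_cases n % 2 <;> simp [ell]
    simp [digitWeight, this]
  have hK : digitWeight n (order n + 1) = 0 := by
    simp [digitWeight, eps_eq_zero_of_lt (lt_two_pow_order_succ n)]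
  have h3 := sum_weight_mul_sub (digitWeight n) (fun l => dirichlet ρ (2 ^ l)) (order n + 1)
  simp only [h0, hK, zero_mul, zero_sub, sub_self] at h3
  rw [h3] at h1
  have h4 : |∑ l ∈ Finset.range (order n + 1),
      (digitWeight n (l + 1) - digitWeight n l) * dirichlet ρ (2 ^ (l + 1))| ≤
      ∑ l ∈ Finset.range (order n + 1),
        |digitWeight n (l + 1) - digitWeight n l| * dirichlet ρ (2 ^ (l + 1)) := by
    refine (Finset.abs_sum_le_sum_abs _ _).trans_eq (Finset.sum_congr rfl fun l _ => ?_)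
    rw [abs_mul, abs_of_nonneg (dirichlet_two_pow_nonneg hρ _)]
  rw [← abs_neg, ← one_mul |_|, ← abs_signWalsh hρ n, ← abs_mul] at h4
  have := abs_sub_abs_le_abs_sub (logKernel ρ n) (signWalsh ρ n * -∑ l ∈ Finset.range (order n + 1),
      (digitWeight n (l + 1) - digitWeight n l) * dirichlet ρ (2 ^ (l + 1)))
  linarith

/-! ### Variation of the digit weights -/

/-- The last term is a reserve with coefficient `2` after a digit zero and `1` after a digit one.
Within a run of ones its growth equals the jump; at a drop the coefficient rises by one, which pays
for the jump; at a rise the old reserve is replaced by twice the variation term and the new reserve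
pays for the jump. -/
lemma sum_abs_digitWeight_sub_le_aux (n K : ℕ) :
    ∑ l ∈ Finset.range K, |digitWeight n (l + 1) - digitWeight n l| ≤
      2 * ∑ k ∈ Finset.range K, |(eps k n : ℝ) - eps (k + 1) n| * ell (n % 2 ^ k) +
        (2 - eps K n) * ell (n % 2 ^ (K + 1)) := by
  induction K with
  | zero =>
    have := ell_nonneg (n % 2 ^ 1)
    have h : (eps 0 n : ℝ) ≤ 1 := by rcases eps_eq_zero_or_one 0 n with h | h <;> simp [h]
    simp only [Finset.range_zero, Finset.sum_empty, zero_add, mul_zero]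
    exact mul_nonneg (by linarith) this
  | succ K ih =>
    rw [Finset.sum_range_succ, Finset.sum_range_succ]
    have h1 : ell (n % 2 ^ K) ≤ ell (n % 2 ^ (K + 1)) :=
      ell_mono (by rw [mod_two_pow_succ_eq]; exact Nat.le_add_right _ _)
    have h2 : ell (n % 2 ^ (K + 1)) ≤ ell (n % 2 ^ (K + 1 + 1)) :=
      ell_mono (by rw [mod_two_pow_succ_eq n (K + 1)]; exact Nat.le_add_right _ _)
    have h0 := ell_nonneg (n % 2 ^ K)
    generalize ∑ l ∈ Finset.range K, |digitWeight n (l + 1) - digitWeight n l| = S at *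
    generalize ∑ k ∈ Finset.range K, |(eps k n : ℝ) - eps (k + 1) n| * ell (n % 2 ^ k) = Y at *
    unfold digitWeight
    rcases eps_eq_zero_or_one K n with h | h <;> rcases eps_eq_zero_or_one (K + 1) n with h' | h' <;>
      rw [h] at ih <;> rw [h, h']
    · simp at ih ⊢; linarith
    · have e : n % 2 ^ (K + 1) = n % 2 ^ K := by rw [mod_two_pow_succ_eq, h]; simp
      rw [e] at ih
      simp at ih ⊢
      rw [abs_of_nonneg (ell_nonneg _)]; linarith
    · have e : n % 2 ^ (K + 1 + 1) = n % 2 ^ (K + 1) := by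
        rw [mod_two_pow_succ_eq n (K + 1), h']; simp
      rw [e]
      simp at ih ⊢
      rw [abs_of_nonneg (ell_nonneg _)]; linarith
    · simp at ih ⊢
      rw [abs_of_nonneg (by linarith)]; linarith

lemma order_mul_logVariation (n : ℕ) :
    (order n : ℝ) * logVariation n =
      ∑ k ∈ Finset.range (order n + 1), |(eps k n : ℝ) - eps (k + 1) n| * ell (n % 2 ^ k) := by
  have h : ∑ k ∈ Finset.Icc 1 (order n),
      |(eps k n : ℝ) - (eps (k + 1) n : ℝ)| * ell (trunc n (k - 1)) =
      ∑ k ∈ Finset.range (order n + 1), |(eps k n : ℝ) - eps (k + 1) n| * ell (n % 2 ^ k) := by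
    rw [Finset.range_eq_Ico, Finset.sum_eq_sum_Ico_succ_bot (Nat.succ_pos _)]
    simp only [pow_zero, Nat.mod_one, ell_zero, mul_zero, zero_add]
    refine Finset.sum_congr rfl fun k hk => ?_
    have hk := Finset.mem_Icc.1 hk
    rw [trunc_eq_mod, Nat.sub_add_cancel hk.1]
  rw [logVariation, h]
  rcases Nat.eq_zero_or_pos (order n) with h0 | h0
  · simp [h0, Nat.mod_one, ell_zero]
  · have : (order n : ℝ) ≠ 0 := by positivity
    field_simp

lemma sum_abs_digitWeight_sub_le (n : ℕ) :
    ∑ l ∈ Finset.range (order n + 1), |digitWeight n (l + 1) - digitWeight n l| ≤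
      2 * (order n * logVariation n) + 2 * ell n := by
  have h := sum_abs_digitWeight_sub_le_aux n (order n + 1)
  have hlt := lt_two_pow_order_succ n
  rw [← order_mul_logVariation, eps_eq_zero_of_lt hlt, Nat.mod_eq_of_lt
    (hlt.trans (Nat.pow_lt_pow_right (by norm_num) (Nat.lt_succ_self _)))] at h
  simpa using h

/-! ### Comparison with Memić's condition -/

lemma order_mul_memicSum (n : ℕ) :
    (order n : ℝ) * memicSum n =
      ∑ k ∈ Finset.range (order n + 1), (eps k n : ℝ) * ell (n % 2 ^ k) := by
  have h : ∑ k ∈ Finset.Icc 1 (order n), (eps k n : ℝ) * ell (trunc n (k - 1)) =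
      ∑ k ∈ Finset.range (order n + 1), (eps k n : ℝ) * ell (n % 2 ^ k) := by
    rw [Finset.range_eq_Ico, Finset.sum_eq_sum_Ico_succ_bot (Nat.succ_pos _)]
    simp only [pow_zero, Nat.mod_one, ell_zero, mul_zero, zero_add]
    refine Finset.sum_congr rfl fun k hk => ?_
    have hk := Finset.mem_Icc.1 hk
    rw [trunc_eq_mod, Nat.sub_add_cancel hk.1]
  rw [memicSum, h]
  rcases Nat.eq_zero_or_pos (order n) with h0 | h0
  · simp [h0, Nat.mod_one, ell_zero]
  · have : (order n : ℝ) ≠ 0 := by positivity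
    field_simp

/-- Termwise `|ε_k - ε_(k+1)| ≤ ε_k + ε_(k+1)`, and monotonicity of `ell` lets the second part be
charged to the Memić term of index `k + 1`. -/
lemma logVariation_le_two_mul_memicSum (n : ℕ) : logVariation n ≤ 2 * memicSum n := by
  rcases Nat.eq_zero_or_pos (order n) with h0 | h0
  · simp [logVariation, memicSum, h0]
  have hpos : (0 : ℝ) < order n := by exact_mod_cast h0
  refine le_of_mul_le_mul_left ?_ hpos
  rw [mul_left_comm, order_mul_memicSum, order_mul_logVariation]
  have h1 : ∑ k ∈ Finset.range (order n + 1), |(eps k n : ℝ) - eps (k + 1) n| * ell (n % 2 ^ k) ≤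
      ∑ k ∈ Finset.range (order n + 1), ((eps k n : ℝ) * ell (n % 2 ^ k) +
        (eps (k + 1) n : ℝ) * ell (n % 2 ^ (k + 1))) := by
    refine Finset.sum_le_sum fun k _ => ?_
    have h1 : ell (n % 2 ^ k) ≤ ell (n % 2 ^ (k + 1)) :=
      ell_mono (by rw [mod_two_pow_succ_eq]; exact Nat.le_add_right _ _)
    have h0 := ell_nonneg (n % 2 ^ k)
    rcases eps_eq_zero_or_one k n with h | h <;> rcases eps_eq_zero_or_one (k + 1) n with h' | h' <;>
      simp [h, h'] <;> linarith
  have h2 : ∑ k ∈ Finset.range (order n + 1), (eps (k + 1) n : ℝ) * ell (n % 2 ^ (k + 1)) =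
      ∑ k ∈ Finset.range (order n + 1), (eps k n : ℝ) * ell (n % 2 ^ k) := by
    have e1 := Finset.sum_range_succ' (fun k => (eps k n : ℝ) * ell (n % 2 ^ k)) (order n + 1)
    rw [Finset.sum_range_succ] at e1
    simp only [eps_eq_zero_of_lt (lt_two_pow_order_succ n), pow_zero, Nat.mod_one, ell_zero,
      mul_zero, add_zero, Nat.cast_zero, zero_mul] at e1
    exact e1.symm
  rw [Finset.sum_add_distrib, h2] at h1
  linarith

lemma order_two_pow_succ_sub_one (A : ℕ) : order (2 ^ (A + 1) - 1) = A := by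
  have : 0 < 2 ^ A := by positivity
  refine (Nat.log_eq_iff (Or.inr ⟨by norm_num, ?_⟩)).2 ⟨?_, ?_⟩ <;> rw [pow_succ] <;> omega

lemma eps_two_pow_sub_one (A k : ℕ) : eps k (2 ^ A - 1) = if k < A then 1 else 0 := by
  unfold eps
  rw [Nat.testBit_two_pow_sub_one]
  split_ifs with h <;> simp [h]

lemma two_pow_sub_one_mod {A k : ℕ} (h : k ≤ A) : (2 ^ A - 1) % 2 ^ k = 2 ^ k - 1 := by
  have h1 : 0 < 2 ^ k := by positivity
  obtain ⟨d, rfl⟩ := Nat.exists_eq_add_of_le h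
  have h2 : 0 < 2 ^ d := by positivity
  have : 2 ^ (k + d) - 1 = (2 ^ k - 1) + 2 ^ k * (2 ^ d - 1) := by
    rw [pow_add, Nat.mul_sub, mul_one]
    have : 2 ^ k ≤ 2 ^ k * 2 ^ d := Nat.le_mul_of_pos_right _ h2
    omega
  rw [this, Nat.add_mul_mod_self_left, Nat.mod_eq_of_lt (by omega)]

lemma logVariation_two_pow_sub_one_le (A : ℕ) : logVariation (2 ^ A - 1) ≤ 1 := by
  rcases A with _ | _ | A
  · simp [logVariation, order]
  · simp [logVariation, order]
  have hpos : (0 : ℝ) < ((A + 1 : ℕ) : ℝ) := by positivity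
  refine le_of_mul_le_mul_left ?_ hpos
  have h := order_mul_logVariation (2 ^ (A + 1 + 1) - 1)
  rw [order_two_pow_succ_sub_one] at h
  -- All digits up to the leading one are equal, so only the drop after the leading digit
  -- contributes.
  rw [h, Finset.sum_range_succ, Finset.sum_eq_zero fun k hk => ?_]
  · rw [eps_two_pow_sub_one, eps_two_pow_sub_one, two_pow_sub_one_mod (by omega),
      if_pos (by omega), if_neg (by omega)]
    have := (ell_mono (Nat.sub_le (2 ^ (A + 1)) 1)).trans (ell_two_pow_le (A + 1))
    simpa using this
  · have hk := Finset.mem_range.1 hk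
    rw [eps_two_pow_sub_one, eps_two_pow_sub_one, if_pos (by omega), if_pos (by omega)]
    simp

/-- Digit `k + 1` contributes at least `ell (2 ^ k) ≥ k / 2`; these add up to `(A + 1) A / 4`, and
the order is `A + 1`. -/
lemma le_memicSum_two_pow_sub_one (A : ℕ) : (A : ℝ) / 4 ≤ memicSum (2 ^ (A + 1 + 1) - 1) := by
  have hpos : (0 : ℝ) < ((A + 1 : ℕ) : ℝ) := by positivity
  refine le_of_mul_le_mul_left ?_ hpos
  have h := order_mul_memicSum (2 ^ (A + 1 + 1) - 1)
  rw [order_two_pow_succ_sub_one] at h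
  rw [h, Finset.sum_range_succ']
  have h1 : ∑ k ∈ Finset.range (A + 1), (k : ℝ) / 2 ≤ ∑ k ∈ Finset.range (A + 1),
      (eps (k + 1) (2 ^ (A + 1 + 1) - 1) : ℝ) * ell ((2 ^ (A + 1 + 1) - 1) % 2 ^ (k + 1)) := by
    refine Finset.sum_le_sum fun k hk => ?_
    have hk := Finset.mem_range.1 hk
    rw [eps_two_pow_sub_one, two_pow_sub_one_mod (by omega), if_pos (by omega), Nat.cast_one,
      one_mul]
    refine (half_le_ell_two_pow k).trans (ell_mono ?_)
    have : 0 < 2 ^ k := by positivity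
    rw [pow_succ]; omega
  have h2 : ∑ k ∈ Finset.range (A + 1), (k : ℝ) / 2 = ((A + 1 : ℕ) : ℝ) * (A / 4) := by
    clear h h1 hpos
    induction A with
    | zero => simp
    | succ A ih => rw [Finset.sum_range_succ, ih]; push_cast; ring
  rw [h2] at h1
  simp only [pow_zero, Nat.mod_one, ell_zero, mul_zero, add_zero]
  exact h1

/-! ### Distribution of the binary digits -/

/-- Lebesgue measure on `[0, 1)`. -/
abbrev unitMeasure : Measure ℝ := volume.restrict (Set.Ico (0 : ℝ) 1)

/-- The first `m` binary digits. -/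
def digitPrefix (m : ℕ) (x : ℝ) : Fin m → Fin 2 := fun k => Real.digits x 2 k

instance isProbabilityMeasure_unitMeasure : IsProbabilityMeasure unitMeasure :=
  ⟨by simp⟩

lemma measurable_digit (k : ℕ) : Measurable fun x : ℝ => Real.digits x 2 k := by
  unfold Real.digits
  exact (measurable_from_top (f := fun n : ℕ => Fin.ofNat 2 n)).comp
    (Nat.measurable_floor.comp (measurable_id.mul_const _))

lemma measurable_digitPrefix (m : ℕ) : Measurable (digitPrefix m) :=
  measurable_pi_lambda _ fun k => measurable_digit k

lemma measureReal_digitPrefix_le (m : ℕ) (v : Fin m → Fin 2) :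
    unitMeasure.real (digitPrefix m ⁻¹' {v}) ≤ (1 / 2) ^ m := by
  set c : ℝ := ∑ i : Fin m, (v i : ℕ) * ((2 : ℝ) ^ ((i : ℕ) + 1))⁻¹ with hc
  have hsub : digitPrefix m ⁻¹' {v} ∩ Set.Ico (0 : ℝ) 1 ⊆ Set.Icc c (c + (1 / 2) ^ m) := by
    rintro x ⟨hx, hx1⟩
    have hsum : ∑ i ∈ Finset.range m, Real.ofDigitsTerm (Real.digits x 2) i = c := by
      rw [hc, ← Fin.sum_univ_eq_sum_range]
      refine Finset.sum_congr rfl fun i _ => ?_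
      have : Real.digits x 2 i = v i := congrFun hx i
      simp [Real.ofDigitsTerm, this]
    have h1 := Real.sum_ofDigitsTerm_digits_le (b := 2) hx1 m
    have h2 := Real.le_sum_ofDigitsTerm_digits (b := 2) hx1 m
    rw [hsum] at h1 h2
    constructor
    · exact h1
    · norm_num at h2 ⊢; linarith
  rw [measureReal_restrict_apply (measurable_digitPrefix m (measurableSet_singleton v))]
  refine (measureReal_mono hsub (by simp)).trans ?_
  rw [Real.volume_real_Icc]
  simp

/-- The `2 ^ m` cells exhaust a probability space and each has mass at most `(1 / 2) ^ m`, so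
equality holds in every bound. -/
lemma measureReal_digitPrefix (m : ℕ) (v : Fin m → Fin 2) :
    unitMeasure.real (digitPrefix m ⁻¹' {v}) = (1 / 2) ^ m := by
  have hsum : ∑ v : Fin m → Fin 2, unitMeasure.real (digitPrefix m ⁻¹' {v}) =
      ∑ v : Fin m → Fin 2, (1 / 2 : ℝ) ^ m := by
    have h := sum_measureReal_preimage_singleton (μ := unitMeasure) (f := digitPrefix m)
      (Finset.univ) (fun v _ => measurable_digitPrefix m (measurableSet_singleton v))
    rw [h]
    simp
  exact (Finset.sum_eq_sum_iff_of_le fun v _ => measureReal_digitPrefix_le m v).1 hsum v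
    (Finset.mem_univ v)

lemma integral_comp_digitPrefix (m : ℕ) (φ : (Fin m → Fin 2) → ℝ) :
    ∫ x, φ (digitPrefix m x) ∂unitMeasure = (1 / 2) ^ m * ∑ v, φ v := by
  have hm := (measurable_digitPrefix m).aemeasurable (μ := unitMeasure)
  have := Measure.isProbabilityMeasure_map hm
  rw [← integral_map hm (f := φ) (measurable_of_countable φ).aestronglyMeasurable,
    integral_fintype .of_finite, Finset.mul_sum]
  refine Finset.sum_congr rfl fun v _ => ?_
  rw [map_measureReal_apply (measurable_digitPrefix m) (measurableSet_singleton v),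
    measureReal_digitPrefix, smul_eq_mul]

lemma measure_digitPrefix_add (m : ℕ) (e : Fin m → Fin 2) (S : Set (Fin m → Fin 2)) :
    unitMeasure {x | digitPrefix m x + e ∈ S} = unitMeasure {x | digitPrefix m x ∈ S} := by
  have hm := measurable_digitPrefix m
  have hae : Measurable fun v : Fin m → Fin 2 => v + e := measurable_of_countable _
  have key : (unitMeasure.map (digitPrefix m)).map (fun v => v + e) =
      unitMeasure.map (digitPrefix m) := by
    refine Measure.ext_of_singleton fun v => ?_
    rw [Measure.map_apply hae (measurableSet_singleton v)]
    have : (fun w : Fin m → Fin 2 => w + e) ⁻¹' {v} = {v - e} := by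
      ext w
      rw [Set.mem_preimage, Set.mem_singleton_iff, Set.mem_singleton_iff, eq_sub_iff_add_eq]
    rw [this, Measure.map_apply hm (measurableSet_singleton _),
      Measure.map_apply hm (measurableSet_singleton _)]
    rw [← measureReal_eq_measureReal_iff, measureReal_digitPrefix, measureReal_digitPrefix]
  have hS : MeasurableSet S := S.toFinite.measurableSet
  have := congrArg (fun ν => ν S) key
  simp only [Measure.map_apply hae hS, Measure.map_apply hm hS, Measure.map_apply hm (hae hS)]
    at this
  exact this

/-- Extension of a finite string of digits by zeros. -/
def extendDigits {m : ℕ} (v : Fin m → Fin 2) (k : ℕ) : Fin 2 := if h : k < m then v ⟨k, h⟩ else 0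

/-- Digit flips preserve the measure of events that depend on finitely many digits; this needs only
the uniform law of the prefix. -/
lemma measure_digits_add_single {m : ℕ} {P : (ℕ → Fin 2) → Prop}
    (hP : ∀ ω ω' : ℕ → Fin 2, (∀ k < m, ω k = ω' k) → (P ω ↔ P ω')) (e : ℕ → Fin 2) :
    unitMeasure {x | P (Real.digits x 2 + e)} = unitMeasure {x | P (Real.digits x 2)} := by
  have h := measure_digitPrefix_add m (fun k => e k) {v | P (extendDigits v)}
  convert h using 3
  · funext x
    refine propext (hP _ _ fun k hk => ?_)
    simp [extendDigits, hk, digitPrefix]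
  · funext x
    refine propext (hP _ _ fun k hk => ?_)
    simp [extendDigits, hk, digitPrefix]

/-! ### The maximal inequality -/

/-- The dyadic interval of level `i` with prescribed digits. -/
def dyadicCell (i : ℕ) (ω : ℕ → Fin 2) : Set ℝ := {t | ∀ k < i, Real.digits t 2 k = ω k}

lemma measurableSet_dyadicCell (i : ℕ) (ω : ℕ → Fin 2) : MeasurableSet (dyadicCell i ω) := by
  have : dyadicCell i ω = ⋂ k ∈ Finset.range i, {t | Real.digits t 2 k = ω k} := by
    ext t; simp [dyadicCell]
  rw [this]
  exact Finset.measurableSet_biInter _ fun k _ => measurable_digit k (measurableSet_singleton _)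

lemma dyadicCell_congr {i : ℕ} {ω ω' : ℕ → Fin 2} (h : ∀ k < i, ω k = ω' k) :
    dyadicCell i ω = dyadicCell i ω' := by
  ext t; exact forall₂_congr fun k hk => by rw [h k hk]

/-- The level `i` is the first one at which the dyadic average of `F` exceeds `c`. -/
def FirstExceeds (F : ℝ → ℝ) (c : ℝ) (i : ℕ) (ω : ℕ → Fin 2) : Prop :=
  c < 2 ^ i * ∫ t in dyadicCell i ω, F t ∂unitMeasure ∧
    ∀ j < i, 2 ^ j * ∫ t in dyadicCell j ω, F t ∂unitMeasure ≤ c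

lemma firstExceeds_congr {F : ℝ → ℝ} {c : ℝ} {i : ℕ} {ω ω' : ℕ → Fin 2}
    (h : ∀ k < i, ω k = ω' k) : FirstExceeds F c i ω ↔ FirstExceeds F c i ω' := by
  unfold FirstExceeds
  rw [dyadicCell_congr h]
  refine and_congr_right fun _ => forall₂_congr fun j hj => ?_
  rw [dyadicCell_congr fun k hk => h k (hk.trans hj)]

lemma exists_firstExceeds {F : ℝ → ℝ} {c : ℝ} {i : ℕ} {ω : ℕ → Fin 2}
    (h : c < 2 ^ i * ∫ t in dyadicCell i ω, F t ∂unitMeasure) :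
    ∃ m ≤ i, FirstExceeds F c m ω := by
  classical
  have hex : ∃ i, c < 2 ^ i * ∫ t in dyadicCell i ω, F t ∂unitMeasure := ⟨i, h⟩
  exact ⟨Nat.find hex, Nat.find_min' hex h, Nat.find_spec hex,
    fun j hj => not_lt.1 (Nat.find_min hex hj)⟩

/-- The points whose digits satisfy `FirstExceeds`. -/
def stopSet (F : ℝ → ℝ) (c : ℝ) (m : ℕ) : Set ℝ := {x | FirstExceeds F c m (Real.digits x 2)}

lemma stopSet_eq_biUnion (F : ℝ → ℝ) (c : ℝ) (m : ℕ) :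
    stopSet F c m = ⋃ v ∈ {v : Fin m → Fin 2 | FirstExceeds F c m (extendDigits v)}.toFinite.toFinset,
      digitPrefix m ⁻¹' {v} := by
  ext x
  simp only [stopSet, Set.mem_ofPred_eq, Set.Finite.mem_toFinset, Set.mem_iUnion, Set.mem_preimage,
    Set.mem_singleton_iff, exists_prop, exists_eq_right']
  exact firstExceeds_congr fun k hk => by simp [extendDigits, hk, digitPrefix]

lemma measurableSet_stopSet (F : ℝ → ℝ) (c : ℝ) (m : ℕ) : MeasurableSet (stopSet F c m) := by
  rw [stopSet_eq_biUnion]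
  exact Finset.measurableSet_biUnion _ fun v _ =>
    measurable_digitPrefix m (measurableSet_singleton v)

lemma digitPrefix_preimage (m : ℕ) (v : Fin m → Fin 2) :
    digitPrefix m ⁻¹' {v} = dyadicCell m (extendDigits v) := by
  ext t
  simp only [Set.mem_preimage, Set.mem_singleton_iff, dyadicCell, Set.mem_ofPred_eq, funext_iff,
    digitPrefix]
  constructor
  · intro h k hk; simpa [extendDigits, hk] using h ⟨k, hk⟩
  · intro h k; simpa [extendDigits] using h k k.2

/-- The stopping set is a disjoint union of cells of level `m`, on each of which the average of `F`
exceeds `c`. -/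
lemma mul_measureReal_stopSet_le {F : ℝ → ℝ} (hF : Integrable F unitMeasure) (c : ℝ) (m : ℕ) :
    c * unitMeasure.real (stopSet F c m) ≤ ∫ t in stopSet F c m, F t ∂unitMeasure := by
  have hmeas := fun v : Fin m → Fin 2 => measurable_digitPrefix m (measurableSet_singleton v)
  have hdisj : ∀ S : Set (Fin m → Fin 2),
      S.PairwiseDisjoint fun v => digitPrefix m ⁻¹' {v} := fun S v _ w _ hvw =>
    Disjoint.preimage _ (Set.disjoint_singleton.2 hvw)
  rw [stopSet_eq_biUnion, measureReal_biUnion_finset (hdisj _) (fun v _ => hmeas v),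
    integral_biUnion_finset _ (fun v _ => hmeas v) (hdisj _) (fun v _ => hF.integrableOn),
    Finset.mul_sum]
  refine Finset.sum_le_sum fun v hv => ?_
  have hv : FirstExceeds F c m (extendDigits v) := by simpa using hv
  rw [measureReal_digitPrefix, digitPrefix_preimage]
  have h1 := hv.1.le
  have h2 : (0 : ℝ) ≤ (1 / 2) ^ m := by positivity
  have h3 := mul_le_mul_of_nonneg_left h1 h2
  rw [← mul_assoc, ← mul_pow] at h3
  norm_num at h3 ⊢
  linarith

lemma pairwise_disjoint_stopSet (F : ℝ → ℝ) (c : ℝ) :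
    Pairwise (Function.onFun Disjoint (stopSet F c)) := by
  have key : ∀ i j, i < j → Disjoint (stopSet F c i) (stopSet F c j) := fun i j hij =>
    Set.disjoint_left.2 fun x hi hj => absurd hi.1 (not_lt.2 (hj.2 i hij))
  intro i j hij
  rcases lt_or_gt_of_ne hij with h | h
  · exact key i j h
  · exact (key j i h).symm

lemma tsum_measure_stopSet_le {F : ℝ → ℝ} (hF : Integrable F unitMeasure) (hF0 : ∀ t, 0 ≤ F t)
    {c : ℝ} (hc : 0 < c) :
    ∑' m, unitMeasure (stopSet F c m) ≤ ENNReal.ofReal ((∫ t, F t ∂unitMeasure) / c) := by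
  have hs := hasSum_integral_iUnion (measurableSet_stopSet F c) (pairwise_disjoint_stopSet F c)
    (hF.integrableOn (s := ⋃ m, stopSet F c m))
  have hs := hs.div_const c
  calc ∑' m, unitMeasure (stopSet F c m)
      ≤ ∑' m, ENNReal.ofReal ((∫ t in stopSet F c m, F t ∂unitMeasure) / c) := by
        refine ENNReal.tsum_le_tsum fun m => ?_
        rw [← ofReal_measureReal]
        refine ENNReal.ofReal_le_ofReal ?_
        rw [le_div_iff₀ hc, mul_comm]
        exact mul_measureReal_stopSet_le hF c m
    _ = ENNReal.ofReal ((∫ t in ⋃ m, stopSet F c m, F t ∂unitMeasure) / c) := by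
        rw [← hs.tsum_eq, ENNReal.ofReal_tsum_of_nonneg _ hs.summable]
        exact fun m => div_nonneg (integral_nonneg hF0) hc.le
    _ ≤ _ := by
        refine ENNReal.ofReal_le_ofReal (div_le_div_of_nonneg_right ?_ hc.le)
        exact setIntegral_le_integral hF (ae_of_all _ hF0)

/-- The products of the Rademacher functions at two points. -/
def signPair (x t : ℝ) (k : ℕ) : ℝ := rademacher k x * rademacher k t

lemma rademacher_eq_one_or_neg_one (k : ℕ) (x : ℝ) : rademacher k x = 1 ∨ rademacher k x = -1 :=
  neg_one_pow_eq_or ℝ _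

lemma signPair_eq_one_or_neg_one (x t : ℝ) (k : ℕ) : signPair x t k = 1 ∨ signPair x t k = -1 := by
  unfold signPair
  rcases rademacher_eq_one_or_neg_one k x with h | h <;>
    rcases rademacher_eq_one_or_neg_one k t with h' | h' <;> simp [h, h']

lemma one_add_signPair (x t : ℝ) (k : ℕ) :
    1 + signPair x t k = if Real.digits t 2 k = Real.digits x 2 k then 2 else 0 := by
  unfold signPair rademacher
  generalize Real.digits x 2 k = a
  generalize Real.digits t 2 k = b
  fin_cases a <;> fin_cases b <;> norm_num

/-- With digit `j` left free, `t` lies in the cell of `x` or in the cell of `x` with that digit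
flipped. -/
lemma skipKernel_signPair (x t : ℝ) (j s : ℕ) :
    skipKernel (signPair x t) (j + 1 + s) j = 2 ^ (j + s) *
      ((dyadicCell (j + 1 + s) (Real.digits x 2)).indicator 1 t +
       (dyadicCell (j + 1 + s) (Real.digits x 2 + Pi.single j 1)).indicator 1 t) := by
  have hcard : ((Finset.range (j + 1 + s)).erase j).card = j + s := by
    rw [Finset.card_erase_of_mem (Finset.mem_range.2 (by omega)), Finset.card_range]; omega
  unfold skipKernel
  simp_rw [one_add_signPair]
  rw [Finset.prod_ite_zero, Finset.prod_const, hcard]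
  have hb : ∀ a b : Fin 2, a ≠ b → a = b + 1 := by decide
  have hb' : ∀ a : Fin 2, a ≠ a + 1 := by decide
  by_cases h : ∀ l ∈ (Finset.range (j + 1 + s)).erase j, Real.digits t 2 l = Real.digits x 2 l
  · rw [if_pos h]
    by_cases hj : Real.digits t 2 j = Real.digits x 2 j
    · rw [Set.indicator_of_mem, Set.indicator_of_notMem]
      · simp
      · intro hmem
        have := hmem j (by omega)
        simp [hj] at this
      · intro l hl
        by_cases hlj : l = j
        · rw [hlj, hj]
        · exact h l (by simp [hlj, hl])
    · rw [Set.indicator_of_notMem, Set.indicator_of_mem]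
      · simp
      · intro l hl
        by_cases hlj : l = j
        · subst hlj; simpa using hb _ _ hj
        · simpa [hlj] using h l (by simp [hlj, hl])
      · exact fun hmem => hj (hmem j (by omega))
  · rw [if_neg h, Set.indicator_of_notMem, Set.indicator_of_notMem]
    · simp
    · intro hmem
      refine h fun l hl => ?_
      have hl := Finset.mem_erase.1 hl
      simpa [hl.1] using hmem l (Finset.mem_range.1 hl.2)
    · intro hmem
      exact h fun l hl => hmem l (Finset.mem_range.1 (Finset.mem_erase.1 hl).2)

lemma integral_mul_skipKernel {F : ℝ → ℝ} (hF : Integrable F unitMeasure) (x : ℝ) (j s : ℕ) :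
    ∫ t, F t * skipKernel (signPair x t) (j + 1 + s) j ∂unitMeasure = 2 ^ (j + s) *
      ((∫ t in dyadicCell (j + 1 + s) (Real.digits x 2), F t ∂unitMeasure) +
       ∫ t in dyadicCell (j + 1 + s) (Real.digits x 2 + Pi.single j 1), F t ∂unitMeasure) := by
  have h1 := measurableSet_dyadicCell (j + 1 + s) (Real.digits x 2)
  have h2 := measurableSet_dyadicCell (j + 1 + s) (Real.digits x 2 + Pi.single j 1)
  rw [← integral_indicator h1, ← integral_indicator h2,
    ← integral_add (hF.indicator h1) (hF.indicator h2), ← integral_const_mul]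
  refine integral_congr_ae (ae_of_all _ fun t => ?_)
  simp only [skipKernel_signPair]
  by_cases h1 : t ∈ dyadicCell (j + 1 + s) (Real.digits x 2) <;>
    by_cases h2 : t ∈ dyadicCell (j + 1 + s) (Real.digits x 2 + Pi.single j 1) <;>
    simp [h1, h2] <;> ring

/-- The integral is the mean of two dyadic averages, so one of them exceeds `c` and has a first
exceeding level `m`. The point then lies in the stopping set or in one of its `s + 1` flipped copies
of the same measure, whence the factor `s + 2`. -/
lemma measure_skip_maximal_le {F : ℝ → ℝ} (hF : Integrable F unitMeasure) (hF0 : ∀ t, 0 ≤ F t)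
    {c : ℝ} (hc : 0 < c) (s : ℕ) :
    unitMeasure {x | ∃ j, c < ∫ t, F t * skipKernel (signPair x t) (j + 1 + s) j ∂unitMeasure} ≤
      (s + 2 : ℕ) * ENNReal.ofReal ((∫ t, F t ∂unitMeasure) / c) := by
  set flipped : ℕ → ℕ → Set ℝ := fun m r =>
    {x | FirstExceeds F c m (Real.digits x 2 + Pi.single (m - 1 - r) 1)} with hflipped
  have hflip : ∀ m r, unitMeasure (flipped m r) = unitMeasure (stopSet F c m) := fun m r =>
    measure_digits_add_single (fun ω ω' h => firstExceeds_congr h) _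
  have hsub : {x | ∃ j, c < ∫ t, F t * skipKernel (signPair x t) (j + 1 + s) j ∂unitMeasure} ⊆
      ⋃ m, (stopSet F c m ∪ ⋃ r ∈ Finset.range (s + 1), flipped m r) := by
    rintro x ⟨j, hj⟩
    rw [integral_mul_skipKernel hF] at hj
    have hor : c < 2 ^ (j + 1 + s) *
          ∫ t in dyadicCell (j + 1 + s) (Real.digits x 2), F t ∂unitMeasure ∨
        c < 2 ^ (j + 1 + s) *
          ∫ t in dyadicCell (j + 1 + s) (Real.digits x 2 + Pi.single j 1), F t ∂unitMeasure := by
      by_contra! hcon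
      have : (2 : ℝ) ^ (j + 1 + s) = 2 * 2 ^ (j + s) := by ring
      rw [this] at hcon
      linarith [hcon.1, hcon.2]
    rw [Set.mem_iUnion]
    rcases hor with h | h
    · obtain ⟨m, -, hm⟩ := exists_firstExceeds h
      exact ⟨m, Or.inl hm⟩
    · obtain ⟨m, hmi, hm⟩ := exists_firstExceeds h
      refine ⟨m, ?_⟩
      -- Stopping at a level `m ≤ j` does not see the flipped digit. Otherwise the digit is recorded
      -- by its distance `m - 1 - j ≤ s` from the stopping level, so that the number of copies does
      -- not depend on `j`.
      rcases le_or_gt m j with hmj | hmj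
      · left
        refine (firstExceeds_congr fun k hk => ?_).1 hm
        simp [(hk.trans_le hmj).ne]
      · right
        simp only [Set.mem_iUnion, Finset.mem_range]
        refine ⟨m - 1 - j, by omega, ?_⟩
        simp only [hflipped, Set.mem_ofPred_eq]
        rwa [show m - 1 - (m - 1 - j) = j by omega]
  calc _ ≤ ∑' m, unitMeasure (stopSet F c m ∪ ⋃ r ∈ Finset.range (s + 1), flipped m r) :=
        (measure_mono hsub).trans (measure_iUnion_le _)
    _ ≤ ∑' m, (s + 2 : ℕ) * unitMeasure (stopSet F c m) := by
        refine ENNReal.tsum_le_tsum fun m => ?_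
        refine (measure_union_le _ _).trans ?_
        have : unitMeasure (⋃ r ∈ Finset.range (s + 1), flipped m r) ≤
            (s + 1 : ℕ) * unitMeasure (stopSet F c m) := by
          refine (measure_biUnion_finset_le _ _).trans ?_
          simp [hflip]
        refine (add_le_add le_rfl this).trans_eq ?_
        push_cast; ring
    _ ≤ _ := by
        rw [ENNReal.tsum_mul_left]
        exact mul_le_mul_right (tsum_measure_stopSet_le hF hF0 hc) _

lemma summable_add_two_mul_geometric :
    Summable fun s : ℕ => ((s + 2 : ℕ) : ℝ) * (2 / 3 : ℝ) ^ s := by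
  have h1 := summable_pow_mul_geometric_of_norm_lt_one 1 (r := (2 / 3 : ℝ)) (by norm_num)
  have h2 := (summable_geometric_of_lt_one (r := (2 / 3 : ℝ)) (by norm_num) (by norm_num)).mul_left 2
  refine (h1.add h2).congr fun s => ?_
  push_cast; ring

/-- The threshold grows like `(3 / 2) ^ s`: a ratio above `1` makes `∑ (s + 2) (2 / 3) ^ s` finite,
and a ratio below `2` keeps the Fejér blocks of order `2 ^ k`. -/
lemma exists_good_set : ∃ C : ℝ, ∀ F : ℝ → ℝ, Integrable F unitMeasure → (∀ t, 0 ≤ F t) →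
    ∀ c : ℝ, 0 < c → ∃ bad : Set ℝ,
      unitMeasure bad ≤ ENNReal.ofReal (C * ((∫ t, F t ∂unitMeasure) / c)) ∧
      ∀ x ∉ bad, ∀ j s,
        ∫ t, F t * skipKernel (signPair x t) (j + 1 + s) j ∂unitMeasure ≤ c * (3 / 2) ^ s := by
  refine ⟨∑' s : ℕ, ((s + 2 : ℕ) : ℝ) * (2 / 3 : ℝ) ^ s, fun F hF hF0 c hc =>
    ⟨⋃ s : ℕ, {x | ∃ j, c * (3 / 2) ^ s <
      ∫ t, F t * skipKernel (signPair x t) (j + 1 + s) j ∂unitMeasure}, ?_, ?_⟩⟩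
  · have hI : 0 ≤ ∫ t, F t ∂unitMeasure := integral_nonneg hF0
    refine (measure_iUnion_le _).trans ?_
    rw [← tsum_mul_right, ENNReal.ofReal_tsum_of_nonneg (fun s => by positivity)
      (summable_add_two_mul_geometric.mul_right _)]
    refine ENNReal.tsum_le_tsum fun s => ?_
    refine (measure_skip_maximal_le hF hF0 (by positivity) s).trans_eq ?_
    rw [← ENNReal.ofReal_natCast, ← ENNReal.ofReal_mul (by positivity)]
    congr 1
    rw [show (2 / 3 : ℝ) = (3 / 2)⁻¹ by norm_num, inv_pow]
    field_simp
  · intro x hx j s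
    simp only [Set.mem_iUnion, Set.mem_ofPred_eq, not_exists, not_lt] at hx
    exact hx s j

/-! ### Kernel representation of the logarithmic means -/

lemma walsh_mul_walsh (i : ℕ) (x t : ℝ) :
    walsh i x * walsh i t = signWalsh (signPair x t) i := by
  simp only [walsh, signWalsh, signPair, mul_pow, Finset.prod_mul_distrib]

lemma measurable_rademacher (k : ℕ) : Measurable (rademacher k) :=
  (measurable_from_top (f := fun a : Fin 2 => (-1 : ℝ) ^ (a : ℕ))).comp (measurable_digit k)

lemma measurable_walsh (i : ℕ) : Measurable (walsh i) := by
  unfold walsh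
  exact Finset.measurable_prod _ fun k _ => (measurable_rademacher k).pow_const _

lemma abs_walsh (i : ℕ) (x : ℝ) : |walsh i x| = 1 :=
  abs_signWalsh (ρ := fun k => rademacher k x) (fun k => rademacher_eq_one_or_neg_one k x) i

lemma measurable_skipKernel (x : ℝ) (k j : ℕ) :
    Measurable fun t => skipKernel (signPair x t) k j := by
  unfold skipKernel signPair
  exact Finset.measurable_prod _ fun l _ =>
    measurable_const.add (measurable_const.mul (measurable_rademacher l))

section Integrability

variable {f : ℝ → ℝ} (hf : Integrable f unitMeasure) (x : ℝ)
include hf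

lemma integrable_mul_walsh (i : ℕ) : Integrable (fun t => f t * walsh i t) unitMeasure :=
  hf.mul_bdd (c := 1) (measurable_walsh i).aestronglyMeasurable
    (ae_of_all _ fun t => by rw [Real.norm_eq_abs, abs_walsh])

lemma integrable_mul_dirichlet (n : ℕ) :
    Integrable (fun t => f t * dirichlet (signPair x t) n) unitMeasure := by
  simp only [dirichlet, Finset.mul_sum, ← walsh_mul_walsh]
  refine integrable_finsetSum _ fun i _ => ?_
  simpa only [mul_left_comm] using (integrable_mul_walsh hf i).const_mul (walsh i x)

lemma integrable_mul_logKernel (n : ℕ) :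
    Integrable (fun t => f t * logKernel (signPair x t) n) unitMeasure := by
  simp only [logKernel, Finset.mul_sum, ← mul_div_assoc]
  exact integrable_finsetSum _ fun j _ => (integrable_mul_dirichlet hf x _).div_const _

lemma integrable_mul_skipKernel (k j : ℕ) :
    Integrable (fun t => f t * skipKernel (signPair x t) k j) unitMeasure := by
  refine hf.mul_bdd (c := ∏ l ∈ (Finset.range k).erase j, (2 : ℝ))
    (measurable_skipKernel x k j).aestronglyMeasurable (ae_of_all _ fun t => ?_)
  rw [Real.norm_eq_abs, abs_of_nonneg (skipKernel_nonneg (signPair_eq_one_or_neg_one x t) k j)]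
  refine Finset.prod_le_prod (fun l _ => one_add_sign_nonneg (signPair_eq_one_or_neg_one x t) l)
    fun l _ => ?_
  rcases signPair_eq_one_or_neg_one x t l with h | h <;> rw [h] <;> norm_num

lemma integrable_mul_fejerBlock (k : ℕ) :
    Integrable (fun t => f t * fejerBlock (signPair x t) k) unitMeasure := by
  simp only [fejerBlock, mul_add, Finset.mul_sum, mul_left_comm (f _)]
  exact ((integrable_mul_dirichlet hf x _).const_mul _).add
    (integrable_finsetSum _ fun j _ => (integrable_mul_skipKernel hf x k j).const_mul _)

lemma integrable_mul_fejerMajorant (p : ℕ) :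
    Integrable (fun t => f t * fejerMajorant (signPair x t) p) unitMeasure := by
  simp only [fejerMajorant, Finset.mul_sum]
  exact integrable_finsetSum _ fun k _ => integrable_mul_fejerBlock hf x k

lemma partialSum_eq_integral (n : ℕ) :
    partialSum n f x = ∫ t, f t * dirichlet (signPair x t) n ∂unitMeasure := by
  simp only [dirichlet, Finset.mul_sum, ← walsh_mul_walsh, partialSum, coeff]
  rw [integral_finsetSum]
  · refine Finset.sum_congr rfl fun i _ => ?_
    rw [← integral_mul_const]
    exact integral_congr_ae (ae_of_all _ fun t => by ring)
  · intro i _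
    simpa only [mul_left_comm] using (integrable_mul_walsh hf i).const_mul (walsh i x)

omit hf in
lemma logKernel_eq_sum_Ico (ρ : ℕ → ℝ) (n : ℕ) :
    logKernel ρ n = ∑ k ∈ Finset.Ico 1 n, dirichlet ρ k / ((n : ℝ) - k) := by
  have h : logKernel ρ n = ∑ j ∈ Finset.Ico 1 n, dirichlet ρ (n - j) / (j : ℝ) := by
    cases n with
    | zero => simp [logKernel]
    | succ n =>
      rw [logKernel, Finset.range_eq_Ico, Finset.sum_eq_sum_Ico_succ_bot (Nat.succ_pos n)]
      simp
  rw [h]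
  refine Finset.sum_nbij' (fun j => n - j) (fun j => n - j) ?_ ?_ ?_ ?_ ?_
  · intro j hj; simp only [Finset.mem_Ico] at *; omega
  · intro j hj; simp only [Finset.mem_Ico] at *; omega
  · intro j hj; simp only [Finset.mem_Ico] at *; omega
  · intro j hj; simp only [Finset.mem_Ico] at *; omega
  · intro j hj
    simp only [Finset.mem_Ico] at hj
    rw [Nat.cast_sub hj.2.le]; congr 1; ring

lemma logMean_eq_integral (n : ℕ) :
    logMean n f x = 1 / ell n * ∫ t, f t * logKernel (signPair x t) n ∂unitMeasure := by
  simp only [logMean, logKernel_eq_sum_Ico, Finset.mul_sum, ← mul_div_assoc]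
  rw [integral_finsetSum _ fun k _ => (integrable_mul_dirichlet hf x k).div_const _,
    Finset.mul_sum]
  refine Finset.sum_congr rfl fun k _ => ?_
  rw [integral_div, partialSum_eq_integral hf]
  ring

end Integrability

/-! ### Kernel integrals at points outside the exceptional set -/

section GoodPoints

variable {F : ℝ → ℝ} (hF : Integrable F unitMeasure) {x c : ℝ} (hc : 0 < c)
  (hx : ∀ j s, ∫ t, F t * skipKernel (signPair x t) (j + 1 + s) j ∂unitMeasure ≤ c * (3 / 2) ^ s)
include hF hx

omit hF in
lemma integral_mul_dirichlet_two_pow_le (l : ℕ) :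
    ∫ t, F t * dirichlet (signPair x t) (2 ^ l) ∂unitMeasure ≤ c := by
  simpa [skipKernel_succ_self] using hx l 0

include hc

lemma integral_mul_fejerBlock_le (k : ℕ) :
    ∫ t, F t * fejerBlock (signPair x t) k ∂unitMeasure ≤ 3 * 2 ^ k * c := by
  simp only [fejerBlock, mul_add, Finset.mul_sum, mul_left_comm (F _)]
  have hI := fun j => (integrable_mul_skipKernel hF x k j).const_mul (2 ^ j : ℝ)
  rw [integral_add ((integrable_mul_dirichlet hF x _).const_mul _)
    (integrable_finsetSum _ fun j _ => hI j), integral_finsetSum _ fun j _ => hI j,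
    integral_const_mul]
  have h1 : (2 : ℝ) ^ k * ∫ t, F t * dirichlet (signPair x t) (2 ^ k) ∂unitMeasure ≤ 2 ^ k * c :=
    mul_le_mul_of_nonneg_left (integral_mul_dirichlet_two_pow_le hx k) (by positivity)
  have h2 : ∑ j ∈ Finset.range k,
      ∫ t, 2 ^ j * (F t * skipKernel (signPair x t) k j) ∂unitMeasure ≤
      ∑ j ∈ Finset.range k, (2 ^ j * (3 / 2) ^ (k - 1 - j)) * c := by
    refine Finset.sum_le_sum fun j hj => ?_
    have hj := Finset.mem_range.1 hj
    rw [integral_const_mul, mul_assoc]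
    refine mul_le_mul_of_nonneg_left ?_ (by positivity)
    have := hx j (k - 1 - j)
    rw [show j + 1 + (k - 1 - j) = k by omega] at this
    linarith
  -- The sum equals `(2 ^ k - (3 / 2) ^ k) / (2 - 3 / 2)`.
  have h3 : ∀ k : ℕ, ∑ j ∈ Finset.range k, (2 : ℝ) ^ j * (3 / 2) ^ (k - 1 - j) ≤ 2 * 2 ^ k := by
    intro k
    have := (Commute.all (2 : ℝ) (3 / 2)).geom_sum₂_mul k
    have h0 : (0 : ℝ) ≤ (3 / 2) ^ k := by positivity
    rw [show (2 : ℝ) - 3 / 2 = 1 / 2 by norm_num] at this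
    linarith
  rw [← Finset.sum_mul] at h2
  have h4 := mul_le_mul_of_nonneg_right (h3 k) hc.le
  linarith

lemma integral_mul_fejerMajorant_le (p : ℕ) :
    ∫ t, F t * fejerMajorant (signPair x t) p ∂unitMeasure ≤ 3 * 2 ^ p * c := by
  simp only [fejerMajorant, Finset.mul_sum]
  rw [integral_finsetSum _ fun k _ => integrable_mul_fejerBlock hF x k]
  refine (Finset.sum_le_sum fun k _ => integral_mul_fejerBlock_le hF hc hx k).trans ?_
  rw [← Finset.sum_mul, ← Finset.mul_sum]
  have : ∑ k ∈ Finset.range p, (2 : ℝ) ^ k ≤ 2 ^ p := by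
    rw [geom_sum_eq (by norm_num)]; norm_num
  gcongr

lemma integral_mul_abs_logKernel_le (hF0 : ∀ t, 0 ≤ F t) (n : ℕ) :
    ∫ t, F t * |logKernel (signPair x t) n| ∂unitMeasure ≤
      (2 * (order n * logVariation n) + 2 * ell n + 18 * order n) * c := by
  have hI1 := fun l => (integrable_mul_dirichlet hF x (2 ^ (l + 1))).const_mul
    |digitWeight n (l + 1) - digitWeight n l|
  have hI2 := fun p => (integrable_mul_fejerMajorant hF x (p + 1)).const_mul (3 / 2 ^ p : ℝ)
  calc ∫ t, F t * |logKernel (signPair x t) n| ∂unitMeasure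
      ≤ ∫ t, (∑ l ∈ Finset.range (order n + 1), |digitWeight n (l + 1) - digitWeight n l| *
          (F t * dirichlet (signPair x t) (2 ^ (l + 1))) +
        ∑ p ∈ Finset.range (order n), 3 / 2 ^ p *
          (F t * fejerMajorant (signPair x t) (p + 1))) ∂unitMeasure := by
        refine integral_mono_of_nonneg
          (ae_of_all _ fun t => mul_nonneg (hF0 t) (abs_nonneg _))
          ((integrable_finsetSum _ fun l _ => hI1 l).add
            (integrable_finsetSum _ fun p _ => hI2 p)) (ae_of_all _ fun t => ?_)
        refine (mul_le_mul_of_nonneg_left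
          (abs_logKernel_le (signPair_eq_one_or_neg_one x t) n) (hF0 t)).trans_eq ?_
        rw [mul_add, Finset.mul_sum, Finset.mul_sum, Finset.mul_sum]
        congr 1
        · exact Finset.sum_congr rfl fun l _ => by ring
        · exact Finset.sum_congr rfl fun p _ => by ring
    _ = ∑ l ∈ Finset.range (order n + 1), |digitWeight n (l + 1) - digitWeight n l| *
          (∫ t, F t * dirichlet (signPair x t) (2 ^ (l + 1)) ∂unitMeasure) +
        ∑ p ∈ Finset.range (order n), 3 / 2 ^ p *
          ∫ t, F t * fejerMajorant (signPair x t) (p + 1) ∂unitMeasure := by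
        rw [integral_add (integrable_finsetSum _ fun l _ => hI1 l)
          (integrable_finsetSum _ fun p _ => hI2 p),
          integral_finsetSum _ fun l _ => hI1 l, integral_finsetSum _ fun p _ => hI2 p]
        simp only [integral_const_mul]
    -- Each scale costs `(3 / 2 ^ p) * (3 * 2 ^ (p + 1)) = 18` times `c`.
    _ ≤ ∑ l ∈ Finset.range (order n + 1), |digitWeight n (l + 1) - digitWeight n l| * c +
        ∑ p ∈ Finset.range (order n), 18 * c := by
        refine add_le_add (Finset.sum_le_sum fun l _ => ?_) (Finset.sum_le_sum fun p _ => ?_)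
        · exact mul_le_mul_of_nonneg_left (integral_mul_dirichlet_two_pow_le hx _) (abs_nonneg _)
        · refine (mul_le_mul_of_nonneg_left (integral_mul_fejerMajorant_le hF hc hx (p + 1))
            (by positivity)).trans_eq ?_
          rw [pow_succ]; field_simp; norm_num
    _ ≤ _ := by
        rw [← Finset.sum_mul, Finset.sum_const, Finset.card_range, nsmul_eq_mul]
        have := mul_le_mul_of_nonneg_right (sum_abs_digitWeight_sub_le n) hc.le
        linarith

end GoodPoints

lemma logVariation_nonneg (n : ℕ) : 0 ≤ logVariation n :=
  mul_nonneg (by positivity) (Finset.sum_nonneg fun _ _ => mul_nonneg (abs_nonneg _) (ell_nonneg _))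

/-- Division by `ell n` with `order n ≤ 2 * ell n` gives `4 * logVariation n + 2 + 36`. -/
lemma abs_logMean_le {f : ℝ → ℝ} (hf : Integrable f unitMeasure) {x c : ℝ} (hc : 0 < c)
    (hx : ∀ j s, ∫ t, |f t| * skipKernel (signPair x t) (j + 1 + s) j ∂unitMeasure ≤
      c * (3 / 2) ^ s) (n : ℕ) :
    |logMean n f x| ≤ (4 * logVariation n + 38) * c := by
  have hV := logVariation_nonneg n
  rcases (ell_nonneg n).eq_or_lt with h0 | h0
  · rw [logMean, ← h0]; simp; positivity
  have hn : n ≠ 0 := by rintro rfl; simp [ell_zero] at h0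
  have h1 := integral_mul_abs_logKernel_le hf.abs hc hx (fun t => abs_nonneg _) n
  have h2 : |∫ t, f t * logKernel (signPair x t) n ∂unitMeasure| ≤
      ∫ t, |f t| * |logKernel (signPair x t) n| ∂unitMeasure := by
    refine (abs_integral_le_integral_abs).trans_eq ?_
    simp only [abs_mul]
  have h3 := order_le_two_mul_ell hn
  rw [logMean_eq_integral hf, abs_mul, abs_of_nonneg (by positivity), one_div, inv_mul_le_iff₀ h0]
  refine (h2.trans h1).trans ?_
  rw [← mul_assoc (ell n)]
  refine mul_le_mul_of_nonneg_right ?_ hc.le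
  have := mul_le_mul_of_nonneg_right h3 hV
  nlinarith

/-! ### Dyadic step functions -/

lemma dirichlet_two_pow_signPair (p : ℕ) (x t : ℝ) :
    dirichlet (signPair x t) (2 ^ p) =
      (digitPrefix p ⁻¹' {digitPrefix p x}).indicator (fun _ => (2 : ℝ) ^ p) t := by
  rw [dirichlet_two_pow]
  simp_rw [one_add_signPair]
  rw [Finset.prod_ite_zero, Finset.prod_const, Finset.card_range]
  have : (∀ l ∈ Finset.range p, Real.digits t 2 l = Real.digits x 2 l) ↔
      t ∈ digitPrefix p ⁻¹' {digitPrefix p x} := by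
    rw [Set.mem_preimage, Set.mem_singleton_iff, funext_iff]
    exact ⟨fun h k => h k (by simp), fun h l hl => h ⟨l, by simpa using hl⟩⟩
  by_cases h : t ∈ digitPrefix p ⁻¹' {digitPrefix p x}
  · rw [if_pos (this.2 h), Set.indicator_of_mem h]
  · rw [if_neg (this.not.2 h), Set.indicator_of_notMem h]

lemma integrable_comp_digitPrefix (p : ℕ) (γ : (Fin p → Fin 2) → ℝ) :
    Integrable (fun x => γ (digitPrefix p x)) unitMeasure := by
  have := Measure.isProbabilityMeasure_map
    (measurable_digitPrefix p).aemeasurable (μ := unitMeasure)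
  exact (Integrable.of_finite (f := γ)).comp_measurable (measurable_digitPrefix p)

lemma partialSum_two_pow_step (p : ℕ) (γ : (Fin p → Fin 2) → ℝ) (x : ℝ) :
    partialSum (2 ^ p) (fun t => γ (digitPrefix p t)) x = γ (digitPrefix p x) := by
  rw [partialSum_eq_integral (integrable_comp_digitPrefix p γ)]
  have h : ∀ t, γ (digitPrefix p t) * dirichlet (signPair x t) (2 ^ p) =
      (digitPrefix p ⁻¹' {digitPrefix p x}).indicator
        (fun _ => γ (digitPrefix p x) * (2 : ℝ) ^ p) t := by
    intro t
    rw [dirichlet_two_pow_signPair]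
    by_cases ht : t ∈ digitPrefix p ⁻¹' {digitPrefix p x}
    · rw [Set.indicator_of_mem ht, Set.indicator_of_mem ht, show digitPrefix p t = _ from ht]
    · rw [Set.indicator_of_notMem ht, Set.indicator_of_notMem ht, mul_zero]
  simp_rw [h]
  rw [integral_indicator_const _ (measurable_digitPrefix p (measurableSet_singleton _)),
    measureReal_digitPrefix, smul_eq_mul, one_div, inv_pow]
  field_simp

/-- The Walsh function of index `i` as a function of the digits. -/
def digitWalsh (i : ℕ) (ω : ℕ → Fin 2) : ℝ :=
  ∏ k ∈ Finset.range (order i + 1), ((-1 : ℝ) ^ (ω k : ℕ)) ^ eps k i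

lemma digitWalsh_add_single {i : ℕ} (hi : i ≠ 0) (ω : ℕ → Fin 2) :
    digitWalsh i (ω + Pi.single (order i) 1) = -digitWalsh i ω := by
  unfold digitWalsh
  have htop : eps (order i) i = 1 := by
    have h1 : 2 ^ order i ≤ i := Nat.pow_log_le_self 2 hi
    have h2 := mod_two_pow_succ_eq i (order i)
    rw [order_mod_succ] at h2
    rcases eps_eq_zero_or_one (order i) i with h | h
    · rw [h] at h2
      have := Nat.mod_lt i (show 0 < 2 ^ order i by positivity)
      omega
    · exact h
  rw [Finset.prod_range_succ, Finset.prod_range_succ, htop]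
  have h1 : ∀ a : Fin 2, (-1 : ℝ) ^ ((a + 1 : Fin 2) : ℕ) = -(-1) ^ (a : ℕ) := by
    intro a; fin_cases a <;> simp
  have h2 : ∏ k ∈ Finset.range (order i),
      ((-1 : ℝ) ^ ((ω + Pi.single (order i) 1 : ℕ → Fin 2) k : ℕ)) ^ eps k i =
      ∏ k ∈ Finset.range (order i), ((-1 : ℝ) ^ (ω k : ℕ)) ^ eps k i := by
    refine Finset.prod_congr rfl fun k hk => ?_
    simp [(Finset.mem_range.1 hk).ne]
  rw [h2]
  simp only [Pi.add_apply, Pi.single_eq_same, h1]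
  ring

/-- Flipping digit `order i ≥ p` changes the sign of `w_i` and leaves the step function alone, so
the sum over prefixes is its own negative. -/
lemma coeff_step_eq_zero {p i : ℕ} (hi : 2 ^ p ≤ i) (γ : (Fin p → Fin 2) → ℝ) :
    coeff (fun t => γ (digitPrefix p t)) i = 0 := by
  have hi0 : i ≠ 0 := by have : 0 < 2 ^ p := by positivity
                         omega
  have hp : p ≤ order i := (Nat.le_log_iff_pow_le (by norm_num) hi0).2 hi
  set φ : (Fin (order i + 1) → Fin 2) → ℝ := fun v =>
    γ (fun k => extendDigits v k) * digitWalsh i (extendDigits v) with hφ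
  have h1 : coeff (fun t => γ (digitPrefix p t)) i =
      ∫ t, φ (digitPrefix (order i + 1) t) ∂unitMeasure := by
    unfold coeff
    refine integral_congr_ae (ae_of_all _ fun t => ?_)
    simp only [hφ]
    congr 1
    · congr 1
      funext k
      simp [extendDigits, digitPrefix, show (k : ℕ) < order i + 1 by omega]
    · unfold walsh digitWalsh rademacher
      refine Finset.prod_congr rfl fun k hk => ?_
      simp [extendDigits, digitPrefix, Finset.mem_range.1 hk]
  have h2 : ∑ v, φ v = 0 := by
    set e : Fin (order i + 1) → Fin 2 :=
      fun k => (Pi.single (order i) 1 : ℕ → Fin 2) k with he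
    have hflip : ∀ v, φ (v + e) = -φ v := by
      intro v
      have hext : extendDigits (v + e) = extendDigits v + Pi.single (order i) 1 := by
        funext k
        by_cases hk : k < order i + 1
        · simp [extendDigits, hk, he]
        · simp [extendDigits, hk, show k ≠ order i by omega]
      simp only [hφ, hext, digitWalsh_add_single hi0]
      rw [mul_neg]
      congr 3
      funext k
      simp [show (k : ℕ) ≠ order i by omega]
    have := Equiv.sum_comp (Equiv.addRight e) φ
    simp only [Equiv.coe_addRight, hflip, Finset.sum_neg_distrib] at this
    linarith
  rw [h1, integral_comp_digitPrefix, h2, mul_zero]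

lemma partialSum_step {p M : ℕ} (hM : 2 ^ p ≤ M) (γ : (Fin p → Fin 2) → ℝ) (x : ℝ) :
    partialSum M (fun t => γ (digitPrefix p t)) x = γ (digitPrefix p x) := by
  rw [← partialSum_two_pow_step p γ x]
  unfold partialSum
  symm
  refine Finset.sum_subset (Finset.range_subset_range.2 hM) fun i _ hi => ?_
  rw [coeff_step_eq_zero (by simpa using hi), zero_mul]

lemma tendsto_ell : Tendsto ell atTop atTop := by
  refine tendsto_atTop_atTop_of_monotone ell_mono fun b => ⟨2 ^ ⌈2 * b⌉₊, ?_⟩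
  have h1 := Nat.le_ceil (2 * b)
  have h2 := half_le_ell_two_pow ⌈2 * b⌉₊
  linarith

lemma ell_eq_sum_sub (n : ℕ) : ell n = ∑ k ∈ Finset.Ico 1 n, 1 / ((n : ℝ) - k) := by
  unfold ell
  refine Finset.sum_nbij' (fun j => n - j) (fun j => n - j) ?_ ?_ ?_ ?_ ?_
  · intro j hj; simp only [Finset.mem_Ico] at *; omega
  · intro j hj; simp only [Finset.mem_Ico] at *; omega
  · intro j hj; simp only [Finset.mem_Ico] at *; omega
  · intro j hj; simp only [Finset.mem_Ico] at *; omega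
  · intro j hj
    simp only [Finset.mem_Ico] at hj
    rw [Nat.cast_sub hj.2.le]; congr 1; ring

/-- The weights `1 / (n - k)` sum to `ell n`, so the error is a weighted average of `S_k g - g`.
Only `k < 2 ^ p` contribute, a bounded total, while `ell n` tends to infinity. -/
lemma tendsto_logMean_step (p : ℕ) (γ : (Fin p → Fin 2) → ℝ) (x : ℝ) :
    Tendsto (fun n => logMean n (fun t => γ (digitPrefix p t)) x) atTop
      (𝓝 (γ (digitPrefix p x))) := by
  set g : ℝ → ℝ := fun t => γ (digitPrefix p t) with hg
  set B := ∑ k ∈ Finset.range (2 ^ p), |partialSum k g x - g x| with hB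
  have hbound : ∀ᶠ n in atTop, |logMean n g x - g x| ≤ B / ell n := by
    filter_upwards [tendsto_ell.eventually_gt_atTop 0] with n hn
    have e : logMean n g x - g x =
        (∑ k ∈ Finset.Ico 1 n, (partialSum k g x - g x) / ((n : ℝ) - k)) / ell n := by
      have : g x = (∑ k ∈ Finset.Ico 1 n, g x / ((n : ℝ) - k)) / ell n := by
        rw [eq_div_iff hn.ne', ell_eq_sum_sub, Finset.mul_sum]
        simp only [mul_one_div]
      conv_lhs => rw [this]
      simp only [logMean, sub_div, Finset.sum_sub_distrib]
      ring
    rw [e, abs_div, abs_of_pos hn]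
    refine div_le_div_of_nonneg_right ?_ hn.le
    refine (Finset.abs_sum_le_sum_abs _ _).trans ?_
    calc ∑ k ∈ Finset.Ico 1 n, |(partialSum k g x - g x) / ((n : ℝ) - k)|
        ≤ ∑ k ∈ Finset.Ico 1 n, |partialSum k g x - g x| := by
          refine Finset.sum_le_sum fun k hk => ?_
          have hk := (Finset.mem_Ico.1 hk).2
          have : (1 : ℝ) ≤ (n : ℝ) - k := by
            have : ((k + 1 : ℕ) : ℝ) ≤ n := by exact_mod_cast hk
            push_cast at this; linarith
          rw [abs_div, abs_of_pos (by linarith : (0 : ℝ) < (n : ℝ) - k)]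
          exact div_le_self (abs_nonneg _) this
      _ ≤ B := by
          rw [hB, ← Finset.sum_filter_ne_zero]
          refine Finset.sum_le_sum_of_subset_of_nonneg (fun k hk => ?_) fun _ _ _ => abs_nonneg _
          by_contra hk'
          refine (Finset.mem_filter.1 hk).2 ?_
          rw [hg, partialSum_step (by simpa using hk'), sub_self, abs_zero]
  rw [tendsto_iff_norm_sub_tendsto_zero]
  exact squeeze_zero' (Eventually.of_forall fun _ => norm_nonneg _) hbound
    (tendsto_const_nhds.div_atTop tendsto_ell)

lemma exists_step_integral_sub_le {f : ℝ → ℝ} (hf : Integrable f unitMeasure) {δ : ℝ}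
    (hδ : 0 < δ) : ∃ (p : ℕ) (γ : (Fin p → Fin 2) → ℝ),
      ∫ t, |f t - γ (digitPrefix p t)| ∂unitMeasure ≤ δ := by
  obtain ⟨g, hgs, hfg, hgc, hgi⟩ := hf.exists_hasCompactSupport_integral_sub_le (half_pos hδ)
  have hgu := hgs.uniformContinuous_of_continuous hgc
  obtain ⟨η, hη, hgη⟩ := Metric.uniformContinuous_iff.1 hgu (δ / 2) (half_pos hδ)
  obtain ⟨p, hp⟩ := exists_pow_lt_of_lt_one hη (by norm_num : (1 / 2 : ℝ) < 1)
  -- The step function takes the value of `g` at the left endpoint of each dyadic interval.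
  set γ : (Fin p → Fin 2) → ℝ := fun v =>
    g (∑ i ∈ Finset.range p, Real.ofDigitsTerm (extendDigits v) i) with hγ
  refine ⟨p, γ, ?_⟩
  have hclose : ∀ t ∈ Set.Ico (0 : ℝ) 1, |g t - γ (digitPrefix p t)| ≤ δ / 2 := by
    intro t ht
    have e : ∑ i ∈ Finset.range p, Real.ofDigitsTerm (extendDigits (digitPrefix p t)) i =
        ∑ i ∈ Finset.range p, Real.ofDigitsTerm (Real.digits t 2) i := by
      refine Finset.sum_congr rfl fun i hi => ?_
      simp [Real.ofDigitsTerm, extendDigits, Finset.mem_range.1 hi, digitPrefix]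
    simp only [hγ, e]
    refine (hgη (a := t) ?_).le
    have h1 := Real.sum_ofDigitsTerm_digits_le (b := 2) ht p
    have h2 := Real.le_sum_ofDigitsTerm_digits (b := 2) ht p
    rw [Real.dist_eq, abs_of_nonneg (by linarith)]
    norm_num at h2 hp
    linarith
  have hstep := integrable_comp_digitPrefix p γ
  have h2 : ∫ t, |g t - γ (digitPrefix p t)| ∂unitMeasure ≤ δ / 2 := by
    refine (integral_mono_ae (hgi.sub hstep).abs (integrable_const (δ / 2)) ?_).trans ?_
    · filter_upwards [ae_restrict_mem measurableSet_Ico] with t ht using hclose t ht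
    · simp
  calc ∫ t, |f t - γ (digitPrefix p t)| ∂unitMeasure
      ≤ ∫ t, (|f t - g t| + |g t - γ (digitPrefix p t)|) ∂unitMeasure :=
        integral_mono (hf.sub hstep).abs ((hf.sub hgi).abs.add (hgi.sub hstep).abs)
          fun t => abs_sub_le _ _ _
    _ = (∫ t, |f t - g t| ∂unitMeasure) + ∫ t, |g t - γ (digitPrefix p t)| ∂unitMeasure :=
        integral_add (hf.sub hgi).abs (hgi.sub hstep).abs
    _ ≤ δ := by
        simp only [Real.norm_eq_abs] at hfg
        linarith

/-! ### Almost everywhere convergence -/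

lemma logMean_sub {f g : ℝ → ℝ} (hf : Integrable f unitMeasure) (hg : Integrable g unitMeasure)
    (n : ℕ) (x : ℝ) :
    logMean n (fun t => f t - g t) x = logMean n f x - logMean n g x := by
  have hfg : Integrable (fun t => f t - g t) unitMeasure := hf.sub hg
  rw [logMean_eq_integral hf, logMean_eq_integral hg, logMean_eq_integral hfg, ← mul_sub,
    ← integral_sub (integrable_mul_logKernel hf x n) (integrable_mul_logKernel hg x n)]
  simp only [sub_mul]

/-- For a step function `g` near `f`, the error splits into the mean of `f - g`, the error for `g`,
and `f - g` itself, each allowed `η / 3`. The first is handled by the maximal bound and the last by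
Markov's inequality, each off a set of measure `O(δ)`. -/
lemma measure_not_eventually_close {f : ℝ → ℝ} (hf : Integrable f unitMeasure) {m : ℕ → ℕ}
    (hm : Tendsto m atTop atTop) {K : ℝ} (hK : ∀ A, logVariation (m A) ≤ K) {η : ℝ} (hη : 0 < η) :
    unitMeasure {x | ¬ ∀ᶠ A in atTop, |logMean (m A) f x - f x| ≤ η} = 0 := by
  obtain ⟨C, hC⟩ := exists_good_set
  have hK0 : 0 ≤ K := (logVariation_nonneg _).trans (hK 0)
  -- Chosen so that the maximal bound becomes `η / 3`; it does not depend on `δ`, which can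
  -- therefore tend to zero afterwards.
  set c : ℝ := η / 3 / (4 * K + 38) with hc_def
  have hc : 0 < c := by positivity
  have hbound : ∀ δ : ℝ, 0 < δ →
      unitMeasure {x | ¬ ∀ᶠ A in atTop, |logMean (m A) f x - f x| ≤ η} ≤
        ENNReal.ofReal (|C| * (δ / c)) + ENNReal.ofReal (δ / (η / 3)) := by
    intro δ hδ
    obtain ⟨p, γ, hγ⟩ := exists_step_integral_sub_le hf hδ
    set g : ℝ → ℝ := fun t => γ (digitPrefix p t) with hg
    have hgi : Integrable g unitMeasure := integrable_comp_digitPrefix p γ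
    have hhi : Integrable (fun t => f t - g t) unitMeasure := hf.sub hgi
    obtain ⟨bad, hbad, hgood⟩ := hC (fun t => |f t - g t|) hhi.abs (fun t => abs_nonneg _) c hc
    have hsub : {x | ¬ ∀ᶠ A in atTop, |logMean (m A) f x - f x| ≤ η} ⊆
        bad ∪ {x | η / 3 ≤ |f x - g x|} := by
      intro x hx
      by_contra hcon
      simp only [Set.mem_union, Set.mem_ofPred_eq, not_or, not_le] at hcon
      refine hx ?_
      have hlim := ((tendsto_logMean_step p γ x).comp hm)
      filter_upwards [Metric.tendsto_nhds.1 hlim (η / 3) (by positivity)] with A hA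
      rw [Real.dist_eq] at hA
      have h1 := abs_logMean_le hhi hc (hgood x hcon.1) (m A)
      rw [logMean_sub hf hgi] at h1
      have h2 : (4 * logVariation (m A) + 38) * c ≤ η / 3 := by
        have : (4 * K + 38) * c = η / 3 := by rw [hc_def]; field_simp
        rw [← this]
        exact mul_le_mul_of_nonneg_right (by linarith [hK A]) hc.le
      have h3 := hcon.2
      simp only [Function.comp] at hA
      rw [show logMean (m A) f x - f x = (logMean (m A) f x - logMean (m A) g x) +
        (logMean (m A) g x - γ (digitPrefix p x)) - (f x - g x) by simp only [hg]; ring]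
      refine (abs_sub _ _).trans ?_
      have := abs_add_le (logMean (m A) f x - logMean (m A) g x)
        (logMean (m A) g x - γ (digitPrefix p x))
      linarith
    refine (measure_mono hsub).trans ((measure_union_le _ _).trans (add_le_add ?_ ?_))
    · refine hbad.trans (ENNReal.ofReal_le_ofReal ?_)
      have h0 : 0 ≤ (∫ t, |f t - g t| ∂unitMeasure) / c :=
        div_nonneg (integral_nonneg fun t => abs_nonneg _) hc.le
      calc _ ≤ |C| * ((∫ t, |f t - g t| ∂unitMeasure) / c) :=
            mul_le_mul_of_nonneg_right (le_abs_self C) h0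
        _ ≤ _ := by gcongr
    · rw [← ofReal_measureReal]
      refine ENNReal.ofReal_le_ofReal ?_
      rw [le_div_iff₀ (by positivity), mul_comm]
      exact (mul_meas_ge_le_integral_of_nonneg (ae_of_all _ fun t => abs_nonneg _) hhi.abs _).trans
        hγ
  have hlim : Tendsto (fun δ : ℝ => ENNReal.ofReal (|C| * (δ / c)) + ENNReal.ofReal (δ / (η / 3)))
      (𝓝[>] 0) (𝓝 0) := by
    have h : Continuous fun δ : ℝ =>
        ENNReal.ofReal (|C| * (δ / c)) + ENNReal.ofReal (δ / (η / 3)) :=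
      (ENNReal.continuous_ofReal.comp (by fun_prop)).add (ENNReal.continuous_ofReal.comp (by fun_prop))
    have := (h.tendsto 0).mono_left (nhdsWithin_le_nhds (s := Set.Ioi 0))
    simpa using this
  refine le_antisymm (ge_of_tendsto hlim ?_) zero_le
  filter_upwards [self_mem_nhdsWithin] with δ hδ using hbound δ hδ

lemma ae_tendsto_logMean {f : ℝ → ℝ} (hf : Integrable f unitMeasure) {m : ℕ → ℕ}
    (hm : Tendsto m atTop atTop) {K : ℝ} (hK : ∀ A, logVariation (m A) ≤ K) :
    ∀ᵐ x ∂unitMeasure, Tendsto (fun A => logMean (m A) f x) atTop (𝓝 (f x)) := by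
  have h : ∀ᵐ x ∂unitMeasure, ∀ k : ℕ,
      ∀ᶠ A in atTop, |logMean (m A) f x - f x| ≤ 1 / ((k : ℝ) + 1) :=
    ae_all_iff.2 fun k => measure_not_eventually_close hf hm hK (by positivity)
  filter_upwards [h] with x hx
  refine Metric.tendsto_nhds.2 fun ε hε => ?_
  obtain ⟨k, hk⟩ := exists_nat_one_div_lt hε
  filter_upwards [hx k] with A hA
  rw [Real.dist_eq]
  exact hA.trans_lt hk

end WalshLog

end

theorem theorem2 :
    -- almost everywhere convergence along every index sequence of bounded logarithmic variation
    (∀ (f : ℝ → ℝ) (m : ℕ → ℕ),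
      IntegrableOn f (Set.Ico (0 : ℝ) 1) volume →
      Tendsto m atTop atTop →
      BddAbove (Set.range fun A : ℕ => WalshLog.logVariation (m A)) →
      ∀ᵐ x ∂(volume.restrict (Set.Ico (0 : ℝ) 1)),
        Tendsto (fun A : ℕ => WalshLog.logMean (m A) f x) atTop (𝓝 (f x))) ∧
    -- the condition is implied by Memić's condition
    (∀ m : ℕ → ℕ,
      BddAbove (Set.range fun A : ℕ => WalshLog.memicSum (m A)) →
      BddAbove (Set.range fun A : ℕ => WalshLog.logVariation (m A))) ∧
    -- it holds for `2 ^ A - 1`, for which Memić's condition fails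
    BddAbove (Set.range fun A : ℕ => WalshLog.logVariation (2 ^ A - 1)) ∧
    ¬ BddAbove (Set.range fun A : ℕ => WalshLog.memicSum (2 ^ A - 1)) := by
  refine ⟨fun f m hf hm ⟨K, hK⟩ => ?_, fun m ⟨K, hK⟩ => ⟨2 * K, ?_⟩, ⟨1, ?_⟩, ?_⟩
  · exact WalshLog.ae_tendsto_logMean hf hm fun A => hK ⟨A, rfl⟩
  · rintro _ ⟨A, rfl⟩
    have h1 : WalshLog.memicSum (m A) ≤ K := hK ⟨A, rfl⟩
    exact (WalshLog.logVariation_le_two_mul_memicSum (m A)).trans (by linarith)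
  · rintro _ ⟨A, rfl⟩
    exact WalshLog.logVariation_two_pow_sub_one_le A
  · rintro ⟨K, hK⟩
    obtain ⟨A, hA⟩ := exists_nat_gt (4 * K)
    have h1 : WalshLog.memicSum (2 ^ (A + 1 + 1) - 1) ≤ K := hK ⟨A + 1 + 1, rfl⟩
    have h2 := WalshLog.le_memicSum_two_pow_sub_one A
    linarith
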